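/- For a finite set $P\subset\mathbb{R}$, an integer $m\le |P|$ and $c\in\mathbb{R}$ let $\mathrm{cost}^{(m)}(P,c)=\min_{L\subseteq P,\,|L|=m}\sum_{p\in P\setminus L}|p-c|$. For a finite set $S\subset\mathbb{R}$ with weights $w:S\to(0,\infty)$, $w(S)=\sum_{p\in S}w(p)\ge m$, let $\mathrm{cost}^{(m)}(S,c)$ be the minimum of $\sum_{p\in S}w'(p)|p-c|$ over all $w':S\to[0,\infty)$ with $w'\le w$ and $\sum_{p\in S}w'(p)=w(S)-m$. A weighted set $(S,w)$ with $S\subseteq P$ is an $\varepsilon$-coreset of $P$ for the robust 1D geometric median if $w(S)=|P|$ and $(1-\varepsilon)\,\mathrm{cost}^{(m)}(P,c)\le\mathrm{cost}^{(m)}(S,c)\le(1+\varepsilon)\,\mathrm{cost}^{(m)}(P,c)$ for every $c\in\mathbb{R}$. **Theorem (optimal coreset for the robust 1D geometric median).** Let $n,m\ge 1$ be integers with $n\ge 4m$, let $\varepsilon\in(0,1)$, and put $f(n,m,\varepsilon)=\varepsilon^{-1/2}+\frac{m}{n}\varepsilon^{-1}$. The implied constants and exponents below are absolute. (1) There is a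 single deterministic algorithm (a real-RAM program with unit-cost comparisons and arithmetic) that, given $m$, $\varepsilon$ and any set $P=\{p_1<\dots<p_n\}\subset\mathbb{R}$ listed in increasing order, outputs in $O(n)$ time an $\varepsilon$-coreset of $P$ of size $\tilde O(f(n,m,\varepsilon))$, where $\tilde O(f)$ means $O\big(f\cdot(1+\log f)^{O(1)}\big)$. (2) If moreover $\varepsilon n>1$, then there is a set $X\subset\mathbb{R}$ of size $n$ such that every $\varepsilon$-coreset of $X$ has size $\Omega(f(n,m,\varepsilon))$; this holds even if the points of the coreset are not required to belong to $X$. -/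

import Mathlib

/-! ### Robust geometric median on the line -/

/-- Robust geometric median cost of a finite dataset `P ⊂ ℝ` with `m` outliers at the center `c`:
the minimum of `∑_{p ∈ P \ L} |p - c|` over all `L ⊆ P` with `|L| = m`.
(For `m ≤ |P|` this is a minimum over a finite nonempty set.) -/
noncomputable def robustCost (m : ℕ) (P : Finset ℝ) (c : ℝ) : ℝ :=
  sInf {x : ℝ | ∃ L : Finset ℝ, L ⊆ P ∧ L.card = m ∧ x = ∑ p ∈ P \ L, dist p c}

/-- Robust geometric median cost of a finite weighted dataset `(S, w)` with outlier weight `m` at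
the center `c`: the minimum of `∑_{p ∈ S} w' p * |p - c|` over all `0 ≤ w' ≤ w` on `S` of total
weight `w(S) - m`. (For `w ≥ 0` and `m ≤ w(S)` the feasible set is compact and nonempty, so the
infimum is attained.) -/
noncomputable def weightedRobustCost (m : ℕ) (S : Finset ℝ) (w : ℝ → ℝ) (c : ℝ) : ℝ :=
  sInf {x : ℝ | ∃ w' : ℝ → ℝ, (∀ p ∈ S, 0 ≤ w' p ∧ w' p ≤ w p) ∧
    ∑ p ∈ S, w' p = (∑ p ∈ S, w p) - m ∧ x = ∑ p ∈ S, w' p * dist p c}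

/-- The weighted set `(S, w)`, not necessarily contained in `P`, has positive weights, the total
weight of `P`, and preserves the robust cost of `P` up to a factor `1 ± ε` at every center. -/
structure PreservesRobustCost (m : ℕ) (ε : ℝ) (P S : Finset ℝ) (w : ℝ → ℝ) : Prop where
  weight_pos : ∀ p ∈ S, 0 < w p
  total_weight : ∑ p ∈ S, w p = P.card
  lower : ∀ c : ℝ, (1 - ε) * robustCost m P c ≤ weightedRobustCost m S w c
  upper : ∀ c : ℝ, weightedRobustCost m S w c ≤ (1 + ε) * robustCost m P c

/-- `(S, w)` is an `ε`-coreset of `P` for robust geometric median with `m` outliers. -/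
structure IsRobustCoreset (m : ℕ) (ε : ℝ) (P S : Finset ℝ) (w : ℝ → ℝ) : Prop
    extends PreservesRobustCost m ε P S w where
  subset : S ⊆ P

/-- The quantity `ε^(-1/2) + (m/n) ε^(-1)`. -/
noncomputable def coresetRate (n m : ℕ) (ε : ℝ) : ℝ :=
  ε ^ (-(1 / 2) : ℝ) + (m : ℝ) / (n : ℝ) * ε⁻¹

/-! ### A real RAM with a step count

Programs in a small imperative language acting on finitely many integer registers, real registers
and real arrays indexed by integers. Available operations are comparisons and arithmetic
(`+`, `-` on integers; `+`, `-`, `*`, `/` on reals), rational constants and the conversion of an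
integer to a real; there is no rounding of reals and there are no other functions. Every
arithmetic operation, memory access, comparison, assignment and evaluated branch costs at least one
step. -/

namespace RealRAM

/-- Memory contents. -/
structure Memory where
  nat : ℕ → ℕ
  real : ℕ → ℝ
  arr : ℕ → ℕ → ℝ

/-- Integer expressions (subtraction is truncated at `0`). -/
inductive NatExp where
  | const (k : ℕ)
  | var (x : ℕ)
  | add (a b : NatExp)
  | sub (a b : NatExp)

namespace NatExp

def eval (σ : Memory) : NatExp → ℕ
  | const k => k
  | var x => σ.nat x
  | add a b => a.eval σ + b.eval σ
  | sub a b => a.eval σ - b.eval σ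

/-- Number of steps needed to evaluate the expression. -/
def steps : NatExp → ℕ
  | const _ => 1
  | var _ => 1
  | add a b => a.steps + b.steps + 1
  | sub a b => a.steps + b.steps + 1

end NatExp

/-- Real expressions; `get a i` reads the entry with index `i` of the array `a`
(a quotient with denominator `0` evaluates to `0`). -/
inductive RealExp where
  | const (q : ℚ)
  | var (x : ℕ)
  | ofNat (e : NatExp)
  | get (a : ℕ) (i : NatExp)
  | add (a b : RealExp)
  | sub (a b : RealExp)
  | mul (a b : RealExp)
  | div (a b : RealExp)

namespace RealExp

noncomputable def eval (σ : Memory) : RealExp → ℝ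
  | const q => (q : ℝ)
  | var x => σ.real x
  | ofNat e => (e.eval σ : ℝ)
  | get a i => σ.arr a (i.eval σ)
  | add a b => a.eval σ + b.eval σ
  | sub a b => a.eval σ - b.eval σ
  | mul a b => a.eval σ * b.eval σ
  | div a b => a.eval σ / b.eval σ

/-- Number of steps needed to evaluate the expression. -/
def steps : RealExp → ℕ
  | const _ => 1
  | var _ => 1
  | ofNat e => e.steps + 1
  | get _ i => i.steps + 1
  | add a b => a.steps + b.steps + 1
  | sub a b => a.steps + b.steps + 1
  | mul a b => a.steps + b.steps + 1
  | div a b => a.steps + b.steps + 1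

end RealExp

/-- Tests. -/
inductive Test where
  | natLt (a b : NatExp)
  | realLt (a b : RealExp)
  | neg (t : Test)
  | conj (s t : Test)

namespace Test

def holds (σ : Memory) : Test → Prop
  | natLt a b => a.eval σ < b.eval σ
  | realLt a b => a.eval σ < b.eval σ
  | neg t => ¬ t.holds σ
  | conj s t => s.holds σ ∧ t.holds σ

/-- Number of steps needed to evaluate the test. -/
def steps : Test → ℕ
  | natLt a b => a.steps + b.steps + 1
  | realLt a b => a.steps + b.steps + 1
  | neg t => t.steps + 1
  | conj s t => s.steps + t.steps + 1

end Test

/-- Programs. -/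
inductive Program where
  | skip
  | setNat (x : ℕ) (e : NatExp)
  | setReal (x : ℕ) (e : RealExp)
  | store (a : ℕ) (i : NatExp) (e : RealExp)
  | seq (p q : Program)
  | ite (t : Test) (p q : Program)
  | loop (t : Test) (p : Program)

/-- `Run p σ τ s`: started with memory `σ`, the program `p` halts with memory `τ` after exactly `s`
steps. -/
inductive Run : Program → Memory → Memory → ℕ → Prop where
  | skip (σ : Memory) : Run Program.skip σ σ 1
  | setNat (x : ℕ) (e : NatExp) (σ : Memory) :
      Run (Program.setNat x e) σ
        { σ with nat := Function.update σ.nat x (e.eval σ) } (e.steps + 1)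
  | setReal (x : ℕ) (e : RealExp) (σ : Memory) :
      Run (Program.setReal x e) σ
        { σ with real := Function.update σ.real x (e.eval σ) } (e.steps + 1)
  | store (a : ℕ) (i : NatExp) (e : RealExp) (σ : Memory) :
      Run (Program.store a i e) σ
        { σ with
          arr := Function.update σ.arr a (Function.update (σ.arr a) (i.eval σ) (e.eval σ)) }
        (i.steps + e.steps + 1)
  | seq {p q : Program} {σ τ ρ : Memory} {s t : ℕ} (hp : Run p σ τ s) (hq : Run q τ ρ t) :
      Run (Program.seq p q) σ ρ (s + t)
  | iteTrue {b : Test} {p : Program} (q : Program) {σ τ : Memory} {s : ℕ}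
      (hb : b.holds σ) (hp : Run p σ τ s) : Run (Program.ite b p q) σ τ (b.steps + 1 + s)
  | iteFalse {b : Test} (p : Program) {q : Program} {σ τ : Memory} {s : ℕ}
      (hb : ¬ b.holds σ) (hq : Run q σ τ s) : Run (Program.ite b p q) σ τ (b.steps + 1 + s)
  | loopStop {b : Test} (p : Program) {σ : Memory} (hb : ¬ b.holds σ) :
      Run (Program.loop b p) σ σ (b.steps + 1)
  | loopStep {b : Test} {p : Program} {σ τ ρ : Memory} {s t : ℕ} (hb : b.holds σ)
      (hp : Run p σ τ s) (hl : Run (Program.loop b p) τ ρ t) :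
      Run (Program.loop b p) σ ρ (b.steps + 1 + s + t)

/-- The initial memory for the dataset `P`, the number of outliers `m` and the accuracy `ε`:
integer registers `0` and `1` hold `|P|` and `m`, real register `0` holds `ε`, array `0` holds the
points of `P` in increasing order, and everything else is `0`. -/
noncomputable def input (P : Finset ℝ) (m : ℕ) (ε : ℝ) : Memory where
  nat := fun x => if x = 0 then P.card else if x = 1 then m else 0
  real := fun x => if x = 0 then ε else 0
  arr := fun a i =>
    if a = 0 then (if h : i < P.card then P.orderEmbOfFin rfl ⟨i, h⟩ else 0) else 0

/-- The memory `σ` presents the weighted set `(S, w)`: with `k` the content of the integer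
register `0`, the first `k` entries of array `0` list the points of `S`, each exactly once, and the
first `k` entries of array `1` are their weights. -/
def Presents (σ : Memory) (S : Finset ℝ) (w : ℝ → ℝ) : Prop :=
  Set.BijOn (σ.arr 0) (Set.Iio (σ.nat 0)) (S : Set ℝ) ∧
    ∀ i < σ.nat 0, w (σ.arr 0 i) = σ.arr 1 i

end RealRAM

/-!
The upper bound rests on a duality. The robust cost at `c` is the maximum over `r` of
`(n - m) * r - ∑ p, max 0 (r - |p - c|)`, and likewise with weights. The tent `max 0 (r - |p - c|)`
is a combination of the three functions `|p - c|`, `|p - (c + r)|` and `|p - (c - r)|`, so only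
the error of the coreset in plain sums of distances matters, at `c` and at the two endpoints of the
ball of the inliers (`weightedRobustCost_le_add_distError`, `robustCost_le_add_distError`).

Cut the sorted points into buckets, and put the mass of a bucket on its two end points so that its
total weight and its mean are kept. The sum of distances to `y` is then exact unless `y` lies inside
the hull of a bucket, in which case the error is nonnegative and at most twice the number of points
of the bucket times the distance from `y` to either end (`Bucketed`, `bucketError_le`). Let `x` be
the distance from `c` to the median and `Q` the robust cost at the median; the cost at `c` is at
least `n * x / 4`, and at least `Q - n * x`. Among the first and last `m` points, buckets of about
`ε * n` points suffice, provided that they do not straddle the boundary of the window of the `n - m`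
points nearest to the median: the endpoints of the inlier ball move by at most `2 * x` away from the
ends of that window, hence lie within `2 * x` of an end of their bucket. In the middle part, where
every point is an inlier, a bucket may grow as long as its number of gaps times its length is at
most about `ε` times `Q + n * y`, where `y` is its distance to the median
(`WindowData.isRobustCoreset`). Greedy buckets are few: each one that was closed by this rule raises
a bounded potential by `1`, which gives `O(ε^(-1/2))` buckets in the middle and `O(m / (n * ε))`
outside (`WindowData.potential_step`, `WindowData.potential_sub_le`). No logarithmic factor is lost.
A single scan of the sorted points builds the buckets, keeping for the current bucket the sum of the
distances to its first point; this gives the linear-time program.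

For the lower bound, the cost of a weighted set is a minimum of functions that are linear between
consecutive points of the set, hence concave there, whereas the cost of the dataset is convex
wherever its inliers do not change. So a coreset has a point in every interval on which the second
difference of the cost exceeds a multiple of `ε` times the cost (`exists_mem_of_secondDiff`). For
consecutive integers with `m` outliers far away this forces about `ε^(-1/2)` points; for a cluster
with groups of about `24 * ε * n` points at geometrically growing distances it forces about
`m / (n * ε)` points.
-/

/-! ### Costs with outliers and their duals -/

theorem robustCost_le {m : ℕ} {P L : Finset ℝ} {c : ℝ} (hL : L ⊆ P) (hm : L.card = m) :
    robustCost m P c ≤ ∑ p ∈ P \ L, dist p c := by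
  refine csInf_le ⟨0, ?_⟩ ⟨L, hL, hm, rfl⟩
  rintro x ⟨L, -, -, rfl⟩
  exact Finset.sum_nonneg fun p _ => dist_nonneg

theorem le_robustCost {m : ℕ} {P : Finset ℝ} {c b : ℝ} (hm : m ≤ P.card)
    (h : ∀ L ⊆ P, L.card = m → b ≤ ∑ p ∈ P \ L, dist p c) : b ≤ robustCost m P c := by
  obtain ⟨L, hL, hc⟩ := Finset.exists_subset_card_eq hm
  refine le_csInf ⟨_, L, hL, hc, rfl⟩ ?_
  rintro x ⟨L, hL, hc, rfl⟩
  exact h L hL hc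

theorem exists_subset_forall_le (d : ℝ → ℝ) {m : ℕ} {P : Finset ℝ} (hm : m ≤ P.card) :
    ∃ L ⊆ P, L.card = m ∧ ∀ p ∈ P \ L, ∀ q ∈ L, d p ≤ d q := by
  induction m with
  | zero => exact ⟨∅, by simp⟩
  | succ m ih =>
    obtain ⟨L, hL, hc, hd⟩ := ih (by omega)
    have hne : (P \ L).Nonempty := by
      rw [← Finset.card_pos, Finset.card_sdiff_of_subset hL]; omega
    obtain ⟨q, hq, hmax⟩ := Finset.exists_max_image (P \ L) d hne
    have hq' := Finset.mem_sdiff.1 hq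
    refine ⟨insert q L, Finset.insert_subset hq'.1 hL, ?_, ?_⟩
    · rw [Finset.card_insert_of_notMem hq'.2, hc]
    · intro p hp r hr
      have hp' : p ∈ P \ L := by
        simp only [Finset.mem_sdiff, Finset.mem_insert, not_or] at hp ⊢
        exact ⟨hp.1, hp.2.2⟩
      rcases Finset.mem_insert.1 hr with rfl | hr
      · exact hmax p hp'
      · exact hd p hp' r hr

theorem sum_le_sum_of_nearest {d : ℝ → ℝ} {P I J : Finset ℝ} (hJ : J ⊆ P) (hc : I.card = J.card)
    (h : ∀ p ∈ I, ∀ q ∈ P \ I, d p ≤ d q) : ∑ p ∈ I, d p ≤ ∑ p ∈ J, d p := by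
  have hcard : (I \ J).card = (J \ I).card := by
    have h1 := Finset.card_sdiff_add_card_inter I J
    have h2 := Finset.card_sdiff_add_card_inter J I
    rw [Finset.inter_comm] at h2
    omega
  have key : ∑ p ∈ I \ J, d p ≤ ∑ p ∈ J \ I, d p := by
    rcases (I \ J).eq_empty_or_nonempty with he | hne
    · have : J \ I = ∅ := by rw [← Finset.card_eq_zero, ← hcard, he]; rfl
      rw [he, this]
    · obtain ⟨q, hq, hmax⟩ := Finset.exists_max_image (I \ J) d hne
      calc ∑ p ∈ I \ J, d p ≤ (I \ J).card • d q := Finset.sum_le_card_nsmul _ _ _ hmax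
        _ = (J \ I).card • d q := by rw [hcard]
        _ ≤ ∑ p ∈ J \ I, d p := by
          refine Finset.card_nsmul_le_sum _ _ _ fun p hp => ?_
          have hp' := Finset.mem_sdiff.1 hp
          exact h q (Finset.mem_sdiff.1 hq).1 p (Finset.mem_sdiff.2 ⟨hJ hp'.1, hp'.2⟩)
  have h1 := Finset.sum_inter_add_sum_sdiff I J d
  have h2 := Finset.sum_inter_add_sum_sdiff J I d
  rw [Finset.inter_comm] at h2
  linarith

theorem robustCost_eq_of_nearest {m : ℕ} {P I : Finset ℝ} {c : ℝ} (hI : I ⊆ P)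
    (hm : I.card + m = P.card) (h : ∀ p ∈ I, ∀ q ∈ P \ I, dist p c ≤ dist q c) :
    robustCost m P c = ∑ p ∈ I, dist p c := by
  refine le_antisymm ?_ (le_robustCost (by omega) fun L hL hc => ?_)
  · have := robustCost_le (m := m) (c := c) (Finset.sdiff_subset (s := P) (t := I))
      (by rw [Finset.card_sdiff_of_subset hI]; omega)
    rwa [Finset.sdiff_sdiff_eq_self hI] at this
  · exact sum_le_sum_of_nearest Finset.sdiff_subset
      (by rw [Finset.card_sdiff_of_subset hL]; omega) h

theorem weightedRobustCost_le {m : ℕ} {S : Finset ℝ} {w w' : ℝ → ℝ} {c : ℝ}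
    (h : ∀ p ∈ S, 0 ≤ w' p ∧ w' p ≤ w p) (hs : ∑ p ∈ S, w' p = (∑ p ∈ S, w p) - m) :
    weightedRobustCost m S w c ≤ ∑ p ∈ S, w' p * dist p c := by
  refine csInf_le ⟨0, ?_⟩ ⟨w', h, hs, rfl⟩
  rintro x ⟨v, hv, -, rfl⟩
  exact Finset.sum_nonneg fun p hp => mul_nonneg (hv p hp).1 dist_nonneg

theorem le_weightedRobustCost {m : ℕ} {S : Finset ℝ} {w : ℝ → ℝ} {c b : ℝ}
    (hw : ∀ p ∈ S, 0 ≤ w p) (hm : (m : ℝ) ≤ ∑ p ∈ S, w p)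
    (h : ∀ w' : ℝ → ℝ, (∀ p ∈ S, 0 ≤ w' p ∧ w' p ≤ w p) →
      ∑ p ∈ S, w' p = (∑ p ∈ S, w p) - m → b ≤ ∑ p ∈ S, w' p * dist p c) :
    b ≤ weightedRobustCost m S w c := by
  have hm0 : (0 : ℝ) ≤ m := m.cast_nonneg
  refine le_csInf ?_ ?_
  · rcases hm0.trans hm |>.eq_or_lt with h0 | hpos
    · refine ⟨_, w, fun p hp => ⟨hw p hp, le_rfl⟩, ?_, rfl⟩
      linarith
    · refine ⟨_, fun p => (1 - m / ∑ p ∈ S, w p) * w p, fun p hp => ⟨?_, ?_⟩, ?_, rfl⟩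
      · exact mul_nonneg (sub_nonneg.2 ((div_le_one hpos).2 hm)) (hw p hp)
      · have := mul_nonneg (div_nonneg hm0 hpos.le) (hw p hp)
        linarith
      · rw [← Finset.mul_sum]
        field_simp
  · rintro x ⟨w', h1, h2, rfl⟩
    exact h w' h1 h2

theorem tent_eq {u r : ℝ} (hr : 0 ≤ r) :
    max 0 (r - |u|) = (|u - r| + |u + r|) / 2 - |u| := by
  rcases max_cases 0 (r - |u|) with ⟨h1, h2⟩ | ⟨h1, h2⟩ <;> rw [h1] <;>
    rcases abs_cases u with ⟨h3, h4⟩ | ⟨h3, h4⟩ <;>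
    rcases abs_cases (u - r) with ⟨h5, h6⟩ | ⟨h5, h6⟩ <;>
    rcases abs_cases (u + r) with ⟨h7, h8⟩ | ⟨h7, h8⟩ <;> linarith

/-- Weak duality for the unweighted robust cost. -/
theorem dual_le_robustCost {m : ℕ} {P : Finset ℝ} (hm : m ≤ P.card) (c r : ℝ) :
    ((P.card : ℝ) - m) * r - ∑ p ∈ P, max 0 (r - dist p c) ≤ robustCost m P c := by
  refine le_robustCost hm fun L hL hc => ?_
  have h1 : ∑ p ∈ P \ L, max 0 (r - dist p c) ≤ ∑ p ∈ P, max 0 (r - dist p c) :=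
    Finset.sum_le_sum_of_subset_of_nonneg Finset.sdiff_subset fun p _ _ => le_max_left _ _
  have h2 : ∑ p ∈ P \ L, (r - dist p c) ≤ ∑ p ∈ P \ L, max 0 (r - dist p c) :=
    Finset.sum_le_sum fun p _ => le_max_right _ _
  rw [Finset.sum_sub_distrib, Finset.sum_const, Finset.card_sdiff_of_subset hL, nsmul_eq_mul,
    Nat.cast_sub (hc ▸ hm), hc] at h2
  linarith

theorem dual_le_weightedRobustCost {m : ℕ} {S : Finset ℝ} {w : ℝ → ℝ}
    (hw : ∀ p ∈ S, 0 ≤ w p) (hm : (m : ℝ) ≤ ∑ p ∈ S, w p) (c r : ℝ) :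
    ((∑ p ∈ S, w p) - m) * r - ∑ p ∈ S, w p * max 0 (r - dist p c) ≤
      weightedRobustCost m S w c := by
  refine le_weightedRobustCost hw hm fun w' h1 h2 => ?_
  rw [← h2, Finset.sum_mul, ← Finset.sum_sub_distrib]
  refine Finset.sum_le_sum fun p hp => ?_
  have h3 : w' p * max 0 (r - dist p c) ≤ w p * max 0 (r - dist p c) :=
    mul_le_mul_of_nonneg_right (h1 p hp).2 (le_max_left _ _)
  have h4 : w' p * (r - dist p c) ≤ w' p * max 0 (r - dist p c) :=
    mul_le_mul_of_nonneg_left (le_max_right _ _) (h1 p hp).1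
  linarith

/-- Strong duality for the weighted robust cost: the dual optimum is a weighted quantile of the
distances to the center. -/
theorem exists_weightedRobustCost_le_dual {m : ℕ} {S : Finset ℝ} {w : ℝ → ℝ}
    (hw : ∀ p ∈ S, 0 < w p) (hm : (m : ℝ) ≤ ∑ p ∈ S, w p) (hS : S.Nonempty) (c : ℝ) :
    ∃ r : ℝ, 0 ≤ r ∧ weightedRobustCost m S w c ≤
      ((∑ p ∈ S, w p) - m) * r - ∑ p ∈ S, w p * max 0 (r - dist p c) := by
  set d : ℝ → ℝ := fun p => dist p c with hd
  set D : ℝ := (∑ p ∈ S, w p) - m with hD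
  have hD0 : 0 ≤ D := sub_nonneg.2 hm
  -- the least distance whose closed ball carries at least the weight of the inliers
  let G := S.filter fun q => D ≤ ∑ p ∈ S with d p ≤ d q, w p
  have hG : G.Nonempty := by
    obtain ⟨q, hq, hmax⟩ := Finset.exists_max_image S d hS
    refine ⟨q, Finset.mem_filter.2 ⟨hq, ?_⟩⟩
    rw [Finset.filter_true_of_mem hmax]
    have : (0 : ℝ) ≤ m := m.cast_nonneg
    linarith
  obtain ⟨q, hq, hmin⟩ := Finset.exists_min_image G d hG
  obtain ⟨hqS, hqD⟩ := Finset.mem_filter.1 hq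
  set r := d q with hr
  have hlt : ∑ p ∈ S with d p < r, w p ≤ D := by
    by_contra! hcon
    have hne : (S.filter fun p => d p < r).Nonempty := by
      by_contra hne
      rw [Finset.not_nonempty_iff_eq_empty] at hne
      rw [hne, Finset.sum_empty] at hcon
      linarith
    obtain ⟨q', hq', hmax⟩ := Finset.exists_max_image _ d hne
    obtain ⟨hq'S, hq'r⟩ := Finset.mem_filter.1 hq'
    refine absurd (hmin q' (Finset.mem_filter.2 ⟨hq'S, hcon.le.trans ?_⟩)) (not_le.2 hq'r)
    refine Finset.sum_le_sum_of_subset_of_nonneg (fun p hp => ?_)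
      (fun p hp _ => (hw p (Finset.mem_filter.1 hp).1).le)
    exact Finset.mem_filter.2 ⟨(Finset.mem_filter.1 hp).1, hmax p hp⟩
  have hsplit : ∑ p ∈ S with d p ≤ r, w p =
      ∑ p ∈ S with d p < r, w p + ∑ p ∈ S with d p = r, w p := by
    simp only [Finset.sum_filter]
    rw [← Finset.sum_add_distrib]
    refine Finset.sum_congr rfl fun p _ => ?_
    rcases lt_trichotomy (d p) r with h | h | h
    · simp [h, h.le, h.ne]
    · simp [h]
    · simp [h.not_ge, h.not_gt, h.ne']
  have hpos : 0 < ∑ p ∈ S with d p = r, w p :=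
    Finset.sum_pos (fun p hp => hw p (Finset.mem_filter.1 hp).1)
      ⟨q, Finset.mem_filter.2 ⟨hqS, rfl⟩⟩
  set A := ∑ p ∈ S with d p < r, w p
  set B := ∑ p ∈ S with d p = r, w p
  set t := (D - A) / B with ht
  have ht0 : 0 ≤ t := div_nonneg (by linarith) hpos.le
  have ht1 : t ≤ 1 := (div_le_one hpos).2 (by linarith)
  set w' : ℝ → ℝ := fun p => if d p < r then w p else if d p = r then t * w p else 0 with hw'
  have hsum : ∑ p ∈ S, w' p = D := by
    have : ∑ p ∈ S, w' p = A + t * B := by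
      simp only [A, B, Finset.sum_filter, Finset.mul_sum]
      rw [← Finset.sum_add_distrib]
      refine Finset.sum_congr rfl fun p _ => ?_
      simp only [hw']
      rcases lt_trichotomy (d p) r with h | h | h
      · simp [h, h.ne]
      · simp [h]
      · simp [h.not_gt, h.ne']
    rw [this, ht]
    field_simp
    ring
  refine ⟨r, dist_nonneg, (weightedRobustCost_le (w' := w') (fun p hp => ?_) hsum).trans
    (le_of_eq ?_)⟩
  · have := hw p hp
    simp only [hw']
    split_ifs
    · exact ⟨this.le, le_rfl⟩
    · exact ⟨by positivity, by nlinarith⟩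
    · exact ⟨le_rfl, this.le⟩
  · rw [← hsum, Finset.sum_mul, ← Finset.sum_sub_distrib]
    refine Finset.sum_congr rfl fun p _ => ?_
    change w' p * d p = w' p * r - w p * max 0 (r - d p)
    simp only [hw']
    rcases lt_trichotomy (d p) r with h | h | h
    · rw [if_pos h, max_eq_right (by linarith)]; ring
    · simp [h]
    · rw [if_neg h.not_gt, if_neg h.ne', max_eq_left (by linarith)]; ring

/-- The error made at `y` by the weighted set `(S, w)` in the sum of distances without outliers. -/
noncomputable def distError (P S : Finset ℝ) (w : ℝ → ℝ) (y : ℝ) : ℝ :=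
  ∑ p ∈ S, w p * |p - y| - ∑ p ∈ P, |p - y|

theorem sum_tent_sub {P S : Finset ℝ} {w : ℝ → ℝ} {c r : ℝ} (hr : 0 ≤ r) :
    ∑ p ∈ S, w p * max 0 (r - dist p c) - ∑ p ∈ P, max 0 (r - dist p c) =
      (distError P S w (c + r) + distError P S w (c - r)) / 2 - distError P S w c := by
  have h1 : ∀ p : ℝ, max 0 (r - dist p c) = (|p - (c + r)| + |p - (c - r)|) / 2 - |p - c| := by
    intro p
    rw [Real.dist_eq, tent_eq hr, ← sub_sub, ← sub_add]
  simp only [h1, distError]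
  simp only [mul_sub, mul_add, mul_div_assoc', Finset.sum_sub_distrib, ← Finset.sum_div,
    Finset.sum_add_distrib]
  ring

theorem weightedRobustCost_le_add_distError {m : ℕ} {P S : Finset ℝ} {w : ℝ → ℝ} {c : ℝ}
    (hw : ∀ p ∈ S, 0 < w p) (hm : m < P.card) (hs : ∑ p ∈ S, w p = P.card)
    (herr : ∀ y, 0 ≤ distError P S w y) :
    weightedRobustCost m S w c ≤ robustCost m P c + distError P S w c := by
  have hm' : (m : ℝ) < P.card := by exact_mod_cast hm
  have hS : S.Nonempty := by
    by_contra h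
    rw [Finset.not_nonempty_iff_eq_empty] at h
    rw [h, Finset.sum_empty] at hs
    have : (0 : ℝ) ≤ m := m.cast_nonneg
    linarith
  obtain ⟨r, hr, h⟩ := exists_weightedRobustCost_le_dual (m := m) hw (by rw [hs]; exact hm'.le) hS c
  have h1 := dual_le_robustCost hm.le c r
  have h2 := sum_tent_sub (P := P) (S := S) (w := w) (c := c) hr
  have h3 := herr (c + r)
  have h4 := herr (c - r)
  rw [hs] at h
  linarith

theorem robustCost_le_add_distError {m : ℕ} {P L S : Finset ℝ} {w : ℝ → ℝ} {c r : ℝ}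
    (hw : ∀ p ∈ S, 0 < w p) (hs : ∑ p ∈ S, w p = P.card)
    (hL : L ⊆ P) (hm : L.card = m) (hr : 0 ≤ r) (h1 : ∀ p ∈ P \ L, dist p c ≤ r)
    (h2 : ∀ p ∈ L, r ≤ dist p c) (herr : 0 ≤ distError P S w c) :
    robustCost m P c ≤ weightedRobustCost m S w c +
      (distError P S w (c + r) + distError P S w (c - r)) / 2 := by
  have hmP : m ≤ P.card := hm ▸ Finset.card_le_card hL
  have h3 := dual_le_weightedRobustCost (m := m) (fun p hp => (hw p hp).le)
    (by rw [hs]; exact_mod_cast hmP) c r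
  have h4 := sum_tent_sub (P := P) (S := S) (w := w) (c := c) hr
  have h5 := robustCost_le (c := c) hL hm
  have h6 : ∑ p ∈ P, max 0 (r - dist p c) = ((P.card : ℝ) - m) * r - ∑ p ∈ P \ L, dist p c := by
    rw [← Finset.sum_sdiff hL, Finset.sum_eq_zero (s := L) fun p hp => max_eq_left (by
        linarith [h2 p hp]), Finset.sum_congr rfl fun p hp => max_eq_right (by
        linarith [h1 p hp]), Finset.sum_sub_distrib, Finset.sum_const,
      Finset.card_sdiff_of_subset hL, nsmul_eq_mul, Nat.cast_sub (hm ▸ hmP), hm, add_zero]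
  rw [hs] at h3
  linarith

/-! ### Lower bounds on the size of a coreset -/

/-- Between two consecutive points of `S`, the weighted robust cost is a minimum of linear functions
of the center, hence concave. -/
theorem weightedRobustCost_midpoint {m : ℕ} {S : Finset ℝ} {w : ℝ → ℝ} {y t : ℝ}
    (hw : ∀ p ∈ S, 0 ≤ w p) (hm : (m : ℝ) ≤ ∑ p ∈ S, w p) (ht : 0 ≤ t)
    (hfree : ∀ p ∈ S, y - t < p → y + t ≤ p) :
    weightedRobustCost m S w (y - t) + weightedRobustCost m S w (y + t) ≤
      2 * weightedRobustCost m S w y := by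
  have : (weightedRobustCost m S w (y - t) + weightedRobustCost m S w (y + t)) / 2 ≤
      weightedRobustCost m S w y := by
    refine le_weightedRobustCost hw hm fun w' h1 h2 => ?_
    have h3 := weightedRobustCost_le (c := y - t) h1 h2
    have h4 := weightedRobustCost_le (c := y + t) h1 h2
    have h5 : ∑ p ∈ S, w' p * dist p (y - t) + ∑ p ∈ S, w' p * dist p (y + t) =
        2 * ∑ p ∈ S, w' p * dist p y := by
      rw [← Finset.sum_add_distrib, Finset.mul_sum]
      refine Finset.sum_congr rfl fun p hp => ?_
      simp only [Real.dist_eq]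
      rcases le_or_gt p (y - t) with h | h
      · rw [abs_of_nonpos (by linarith), abs_of_nonpos (by linarith), abs_of_nonpos (by linarith)]
        ring
      · have := hfree p hp h
        rw [abs_of_nonneg (by linarith), abs_of_nonneg (by linarith), abs_of_nonneg (by linarith)]
        ring
    linarith
  linarith

/-- If the inliers `I` of `X` are the same at the centers `y - t`, `y`, `y + t` and the second
difference of the cost there is large, then the interval `(y - t, y + t)` contains a point of the
coreset, as otherwise the concave coreset cost could not follow the convex cost of `X`. -/
theorem exists_mem_of_secondDiff {m : ℕ} {ε y t F : ℝ} {X S I : Finset ℝ} {w : ℝ → ℝ}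
    (h : PreservesRobustCost m ε X S w) (hε : 0 < ε) (hI : I ⊆ X) (hm : I.card + m = X.card)
    (ht : 0 ≤ t)
    (hnear : ∀ c, y - t ≤ c → c ≤ y + t → ∀ p ∈ I, ∀ q ∈ X \ I, |p - c| ≤ |q - c|)
    (hF : ∀ c, y - t ≤ c → c ≤ y + t → ∑ p ∈ I, |p - c| ≤ F)
    (hgap : 4 * ε * F < ∑ p ∈ I, (|p - (y - t)| + |p - (y + t)| - 2 * |p - y|)) :
    ∃ p ∈ S, y - t < p ∧ p < y + t := by
  by_contra! hcon
  have hX : ∀ c, y - t ≤ c → c ≤ y + t → robustCost m X c = ∑ p ∈ I, |p - c| := fun c h1 h2 =>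
    robustCost_eq_of_nearest hI hm (hnear c h1 h2)
  have hcard : (m : ℝ) ≤ X.card := by exact_mod_cast (by omega : m ≤ X.card)
  have hmid := weightedRobustCost_midpoint (m := m) (fun p hp => (h.weight_pos p hp).le)
    (by rw [h.total_weight]; exact hcard) ht hcon
  have h1 := h.lower (y - t)
  have h2 := h.lower (y + t)
  have h3 := h.upper y
  rw [hX _ le_rfl (by linarith)] at h1
  rw [hX _ (by linarith) le_rfl] at h2
  rw [hX _ (by linarith) (by linarith)] at h3
  rw [Finset.sum_sub_distrib, Finset.sum_add_distrib, ← Finset.mul_sum] at hgap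
  have f1 := mul_le_mul_of_nonneg_left (hF (y - t) le_rfl (by linarith)) hε.le
  have f2 := mul_le_mul_of_nonneg_left (hF (y + t) (by linarith) le_rfl) hε.le
  have f3 := mul_le_mul_of_nonneg_left (hF y (by linarith) (by linarith)) hε.le
  linarith

theorem secondDiff_nonneg {p y t : ℝ} : 0 ≤ |p - (y - t)| + |p - (y + t)| - 2 * |p - y| := by
  have := abs_add_le (p - (y - t)) (p - (y + t))
  rw [show p - (y - t) + (p - (y + t)) = 2 * (p - y) by ring, abs_mul, abs_two] at this
  linarith

theorem le_secondDiff {p y t : ℝ} :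
    2 * (t - |p - y|) ≤ |p - (y - t)| + |p - (y + t)| - 2 * |p - y| := by
  have h1 := le_abs_self (p - (y - t))
  have h2 := neg_le_abs (p - (y + t))
  linarith

theorem le_card_of_disjoint_intervals {S : Finset ℝ} {q : ℕ} {a b : ℕ → ℝ}
    (hab : ∀ i j, i < j → j < q → b i ≤ a j) (h : ∀ j < q, ∃ p ∈ S, a j < p ∧ p < b j) :
    q ≤ S.card := by
  choose! f hf using h
  rw [← Finset.card_range q]
  refine Finset.card_le_card_of_injOn f (fun j hj => (hf j (by simpa using hj)).1) ?_
  have hlt : ∀ i j, i < j → j < q → f i < f j := fun i j hij hj =>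
    (hf i (hij.trans hj)).2.2.trans_le ((hab i j hij hj).trans (hf j hj).2.1.le)
  intro i hi j hj hij
  simp only [Finset.coe_range, Set.mem_Iio] at hi hj
  rcases lt_trichotomy i j with h | h | h
  · exact absurd hij (hlt i j h hj).ne
  · exact h
  · exact absurd hij (hlt j i h hi).ne'

/-- A dataset with consecutive integers and `m` points far away: near the integers its cost is
strongly convex, which forces about `ε^(-1/2)` coreset points. -/
theorem exists_forall_inv_sqrt_le_card {n m : ℕ} {ε : ℝ} (hmn : 4 * m ≤ n) (hε : 0 < ε)
    (hε1 : ε < 1) (hn : 1 < ε * n) :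
    ∃ X : Finset ℝ, X.card = n ∧ ∀ (S : Finset ℝ) (w : ℝ → ℝ), PreservesRobustCost m ε X S w →
      (√ε)⁻¹ ≤ 8 * (S.card + 1) := by
  set N := n - m with hN
  have hn0 : 0 < n := by
    rcases Nat.eq_zero_or_pos n with h | h
    · simp [h] at hn; linarith
    · exact h
  have hnR : (0 : ℝ) < n := by exact_mod_cast hn0
  have hNR : 3 / 4 * (n : ℝ) ≤ N := by
    have : (3 * n : ℝ) ≤ 4 * N := by exact_mod_cast (by omega : 3 * n ≤ 4 * N)
    linarith
  have hNn : (N : ℝ) ≤ n := by exact_mod_cast (by omega : N ≤ n)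
  let I : Finset ℝ := (Finset.range N).image (Nat.cast : ℕ → ℝ)
  let X : Finset ℝ := (Finset.range N ∪ Finset.Ico (10 * n) (10 * n + m)).image (Nat.cast : ℕ → ℝ)
  have hIc : I.card = N := by
    rw [Finset.card_image_of_injective _ Nat.cast_injective, Finset.card_range]
  have hXc : X.card = n := by
    rw [Finset.card_image_of_injective _ Nat.cast_injective, Finset.card_union_of_disjoint,
      Finset.card_range, Nat.card_Ico]
    · omega
    · rw [Finset.disjoint_left]
      intro i hi hi'
      simp only [Finset.mem_range, Finset.mem_Ico] at hi hi'
      omega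
  have hIX : I ⊆ X := Finset.image_subset_image Finset.subset_union_left
  refine ⟨X, hXc, fun S w h => ?_⟩
  have hs0 : 0 < √ε := Real.sqrt_pos.2 hε
  have hss : √ε * √ε = ε := Real.mul_self_sqrt hε.le
  have hs1 : √ε < 1 := by nlinarith
  have hsn : 1 < √ε * n := by nlinarith
  set l := ⌊2 * (√ε * n)⌋₊ + 1 with hl
  have hl1 : 2 * (√ε * n) < l := by
    rw [hl]; push_cast; exact Nat.lt_floor_add_one _
  have hl2 : (l : ℝ) ≤ 3 * (√ε * n) := by
    have := Nat.floor_le (a := 2 * (√ε * n)) (by positivity)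
    rw [hl]; push_cast; linarith
  set q := N / (2 * l) with hq
  have hlpos : 0 < 2 * l := by omega
  have hqN : 2 * l * q ≤ N := Nat.mul_div_le _ _
  have hqN' : N < 2 * l * (q + 1) := Nat.lt_mul_div_succ N hlpos
  have key : q ≤ S.card := by
    refine le_card_of_disjoint_intervals (a := fun j => (2 * j + 1 : ℝ) * l - l)
      (b := fun j => (2 * j + 1 : ℝ) * l + l) ?_ ?_
    · intro i j hij _
      have h1 : (i : ℝ) + 1 ≤ j := by exact_mod_cast hij
      have h2 : (0 : ℝ) ≤ l := l.cast_nonneg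
      nlinarith
    · intro j hj
      have hj' : 2 * l * (j + 1) ≤ N := (Nat.mul_le_mul_left _ hj).trans hqN
      have hjR : 2 * (l : ℝ) * (j + 1) ≤ N := by exact_mod_cast hj'
      have hlR : (0 : ℝ) ≤ l := l.cast_nonneg
      have hjl : (0 : ℝ) ≤ j * l := by positivity
      have hdist : ∀ c, (2 * j + 1 : ℝ) * l - l ≤ c → c ≤ (2 * j + 1 : ℝ) * l + l →
          ∀ p ∈ I, |p - c| ≤ n := by
        intro c hc1 hc2 p hp
        obtain ⟨i, hi, rfl⟩ := Finset.mem_image.1 hp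
        have : (i : ℝ) ≤ N := by exact_mod_cast (Finset.mem_range.1 hi).le
        have : (0 : ℝ) ≤ i := i.cast_nonneg
        rw [abs_le]
        constructor <;> linarith
      refine exists_mem_of_secondDiff (F := n * n) h hε hIX (by omega) hlR ?_ ?_ ?_
      · intro c hc1 hc2 p hp r hr
        refine (hdist c hc1 hc2 p hp).trans ?_
        obtain ⟨hrX, hrI⟩ := Finset.mem_sdiff.1 hr
        obtain ⟨i, hi, rfl⟩ := Finset.mem_image.1 hrX
        rcases Finset.mem_union.1 hi with hi | hi
        · exact absurd (Finset.mem_image_of_mem _ hi) hrI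
        · have : (10 * n : ℝ) ≤ i := by exact_mod_cast (Finset.mem_Ico.1 hi).1
          refine le_trans ?_ (le_abs_self _)
          linarith
      · intro c hc1 hc2
        refine (Finset.sum_le_card_nsmul _ _ _ (hdist c hc1 hc2)).trans ?_
        rw [hIc, nsmul_eq_mul]
        exact mul_le_mul_of_nonneg_right hNn hnR.le
      · set y := (2 * j + 1) * l with hy
        have hsum : ∀ k : ℕ, (k : ℝ) * k ≤ ∑ i ∈ Finset.range k, 2 * ((k : ℝ) - i) := by
          intro k
          induction k with
          | zero => simp
          | succ k ih =>
            rw [Finset.sum_range_succ]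
            simp only [← Finset.mul_sum, Finset.sum_sub_distrib, Finset.sum_const,
              Finset.card_range, nsmul_eq_mul] at ih ⊢
            push_cast
            nlinarith
        have hsub : (Finset.range l).image (fun i : ℕ => ((y + i : ℕ) : ℝ)) ⊆ I := by
          intro p hp
          obtain ⟨i, hi, rfl⟩ := Finset.mem_image.1 hp
          refine Finset.mem_image_of_mem _ (Finset.mem_range.2 ?_)
          have := Finset.mem_range.1 hi
          have : y + l = 2 * l * (j + 1) := by rw [hy]; ring
          omega
        have hyR : ((2 * j + 1 : ℝ)) * l = y := by rw [hy]; push_cast; ring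
        rw [hyR]
        calc 4 * ε * (n * n) = (2 * (√ε * n)) * (2 * (√ε * n)) := by
              linear_combination (-4 * (n : ℝ) * n) * hss
          _ < l * l := by
            have : 0 < 2 * (√ε * n) := by positivity
            nlinarith
          _ ≤ ∑ i ∈ Finset.range l, 2 * ((l : ℝ) - i) := hsum l
          _ ≤ ∑ i ∈ Finset.range l, (|((y + i : ℕ) : ℝ) - (y - l)| + |((y + i : ℕ) : ℝ) - (y + l)| -
              2 * |((y + i : ℕ) : ℝ) - y|) := by
            refine Finset.sum_le_sum fun i _ => le_trans (le_of_eq ?_) le_secondDiff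
            push_cast
            rw [add_sub_cancel_left, abs_of_nonneg i.cast_nonneg]
          _ = ∑ p ∈ (Finset.range l).image (fun i : ℕ => ((y + i : ℕ) : ℝ)),
              (|p - (y - l)| + |p - (y + l)| - 2 * |p - y|) := by
            rw [Finset.sum_image]
            intro i _ i' _ hii
            have hii' : ((y + i : ℕ) : ℝ) = ((y + i' : ℕ) : ℝ) := hii
            have : y + i = y + i' := by exact_mod_cast hii'
            omega
          _ ≤ _ := Finset.sum_le_sum_of_subset_of_nonneg hsub fun p _ _ => secondDiff_nonneg
  have hcount : (N : ℝ) < 2 * l * (q + 1) := by exact_mod_cast hqN'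
  have hqS : (q : ℝ) ≤ S.card := by exact_mod_cast key
  have h1 : 3 / 4 * (n : ℝ) < 6 * (√ε * n) * (S.card + 1) := by
    calc 3 / 4 * (n : ℝ) ≤ N := hNR
      _ < 2 * l * (q + 1) := hcount
      _ ≤ 2 * (3 * (√ε * n)) * (S.card + 1) := by gcongr
      _ = 6 * (√ε * n) * (S.card + 1) := by ring
  rw [inv_le_iff_one_le_mul₀ hs0]
  nlinarith

/-- A dataset with a cluster and `m` points in groups of about `24 ε n` at geometrically growing
distances: the cost at a center inside a group is of order `n` times the distance to the cluster,
while the group makes a convex kink of its own cardinality there. -/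
theorem exists_forall_div_le_card {n m : ℕ} {ε : ℝ} (hmn : 4 * m ≤ n) (hε : 0 < ε)
    (hn : 1 < ε * n) :
    ∃ X : Finset ℝ, X.card = n ∧ ∀ (S : Finset ℝ) (w : ℝ → ℝ), PreservesRobustCost m ε X S w →
      (m : ℝ) / n * ε⁻¹ ≤ 25 * (S.card + 1) := by
  have hn0 : 0 < n := by
    rcases Nat.eq_zero_or_pos n with h | h
    · simp [h] at hn; linarith
    · exact h
  have hnR : (0 : ℝ) < n := by exact_mod_cast hn0
  set k := ⌊24 * (ε * n)⌋₊ + 1 with hk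
  have hk1 : 24 * (ε * n) < k := by
    rw [hk]; push_cast; exact Nat.lt_floor_add_one _
  have hk2 : (k : ℝ) ≤ 25 * (ε * n) := by
    have := Nat.floor_le (a := 24 * (ε * n)) (by positivity)
    rw [hk]; push_cast; linarith
  have hk0 : 0 < k := by omega
  let T : ℕ → ℝ := fun j => 16 * n * 4 ^ j
  have hTmono : Monotone T := fun i j hij => by
    simp only [T]; gcongr; norm_num
  have hT0 : ∀ j, 16 * (n : ℝ) ≤ T j := fun j => by
    have := hTmono (Nat.zero_le j)
    simpa [T] using this
  have hTs : ∀ j, T (j + 1) = 4 * T j := fun j => by simp only [T, pow_succ]; ring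
  let τ : ℕ → ℝ := fun i => T (i / k) + i
  have hτ : StrictMono τ := fun i j hij =>
    add_lt_add_of_le_of_lt (hTmono (Nat.div_le_div_right hij.le)) (by exact_mod_cast hij)
  let cl : ℕ → Finset ℝ := fun a => (Finset.range a).image fun i : ℕ => -(i : ℝ)
  let tl : ℕ → Finset ℝ := fun a => (Finset.range a).image τ
  have hτ0 : ∀ i, 0 < τ i := fun i => by
    have := hT0 (i / k)
    have : (0 : ℝ) ≤ i := i.cast_nonneg
    simp only [τ]; linarith
  have hcard : ∀ a b, (cl a ∪ tl b).card = a + b := by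
    intro a b
    rw [Finset.card_union_of_disjoint, Finset.card_image_of_injective _ hτ.injective,
      Finset.card_image_of_injective, Finset.card_range, Finset.card_range]
    · intro i j hij
      simpa using hij
    · rw [Finset.disjoint_left]
      intro p hp hp'
      obtain ⟨i, -, rfl⟩ := Finset.mem_image.1 hp
      obtain ⟨i', -, h'⟩ := Finset.mem_image.1 hp'
      have h1 := hτ0 i'
      have h2 : (0 : ℝ) ≤ i := i.cast_nonneg
      have h3 : τ i' = -(i : ℝ) := h'
      linarith
  have hmnR : 4 * (m : ℝ) ≤ n := by exact_mod_cast hmn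
  refine ⟨cl (n - m) ∪ tl m, by rw [hcard]; omega, fun S w h => ?_⟩
  set q := m / k with hq
  have hqm : k * q ≤ m := Nat.mul_div_le _ _
  have hqm' : m < k * (q + 1) := Nat.lt_mul_div_succ m hk0
  have key : q ≤ S.card := by
    refine le_card_of_disjoint_intervals (a := fun j => T j - T j / 4)
      (b := fun j => T j + T j / 4) ?_ ?_
    · intro i j hij _
      have h1 := hTmono (Nat.succ_le_of_lt hij)
      rw [Nat.succ_eq_add_one, hTs] at h1
      have := hT0 i
      have := hT0 j
      linarith
    · intro j hj
      have hjm : k * (j + 1) ≤ m := (Nat.mul_le_mul_left _ hj).trans hqm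
      have hTj := hT0 j
      have hclose : ∀ c, T j - T j / 4 ≤ c → c ≤ T j + T j / 4 →
          (∀ i < k * (j + 1), |τ i - c| ≤ c) := by
        intro c hc1 hc2 i hi
        have h1 : i / k ≤ j := by
          have : i / k < j + 1 := Nat.div_lt_of_lt_mul hi
          omega
        have h2 := hTmono h1
        have h3 : (i : ℝ) ≤ m := by exact_mod_cast (hi.le.trans hjm)
        have h4 := hτ0 i
        have h5 : τ i = T (i / k) + i := rfl
        rw [abs_le]
        constructor <;> linarith
      have hsubτ : ∀ {a b : ℕ}, a ≤ b → tl a ⊆ tl b := fun hab =>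
        Finset.image_subset_image (Finset.range_subset_range.2 hab)
      have hsubc : ∀ {a b : ℕ}, a ≤ b → cl a ⊆ cl b := fun hab =>
        Finset.image_subset_image (Finset.range_subset_range.2 hab)
      refine exists_mem_of_secondDiff (I := cl (n - m - k * (j + 1)) ∪ tl (k * (j + 1)))
        (F := n * (3 / 2 * T j)) h hε (Finset.union_subset_union (hsubc (by omega)) (hsubτ hjm))
        (by rw [hcard, hcard]; omega) (by linarith) ?_ ?_ ?_
      · intro c hc1 hc2 p hp r hr
        obtain ⟨hrX, hrI⟩ := Finset.mem_sdiff.1 hr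
        rw [Finset.mem_union, not_or] at hrI
        have hp' : |p - c| ≤ c + n - m - k * (j + 1) ∧ (|p - c| ≤ c ∨
            ∃ i < n - m - k * (j + 1), |p - c| = c + i) := by
          have hb : (k : ℝ) * (j + 1) + m ≤ n := by
            exact_mod_cast (by omega : k * (j + 1) + m ≤ n)
          rcases Finset.mem_union.1 hp with hp | hp
          · obtain ⟨i, hi, rfl⟩ := Finset.mem_image.1 hp
            have hi := Finset.mem_range.1 hi
            have hii : |-(i : ℝ) - c| = c + i := by
              rw [← abs_neg, neg_sub, sub_neg_eq_add, abs_of_nonneg]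
              have : (0 : ℝ) ≤ i := i.cast_nonneg
              linarith
            refine ⟨?_, Or.inr ⟨i, hi, hii⟩⟩
            have : (i : ℝ) + m + k * (j + 1) ≤ n := by
              exact_mod_cast (by omega : i + m + k * (j + 1) ≤ n)
            rw [hii]; linarith
          · obtain ⟨i, hi, rfl⟩ := Finset.mem_image.1 hp
            have := hclose c hc1 hc2 i (Finset.mem_range.1 hi)
            exact ⟨by linarith, Or.inl this⟩
        have hkj : (0 : ℝ) ≤ k * (j + 1) := by positivity
        have hm0 : (0 : ℝ) ≤ m := m.cast_nonneg
        rcases Finset.mem_union.1 hrX with hr | hr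
        · obtain ⟨i, hi, rfl⟩ := Finset.mem_image.1 hr
          have hii : n - m - k * (j + 1) ≤ i := by
            by_contra hlt
            exact hrI.1 (Finset.mem_image_of_mem _ (Finset.mem_range.2 (by omega)))
          have hi0 : (0 : ℝ) ≤ i := i.cast_nonneg
          refine le_trans ?_ (neg_le_abs _)
          rcases hp'.2 with hp | ⟨i', hi', hp⟩
          · linarith
          · have : (i' : ℝ) ≤ i := by exact_mod_cast hi'.le.trans hii
            linarith
        · obtain ⟨i, hi, rfl⟩ := Finset.mem_image.1 hr
          have hii : k * (j + 1) ≤ i := by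
            by_contra hlt
            exact hrI.2 (Finset.mem_image_of_mem _ (Finset.mem_range.2 (by omega)))
          have h1 : j + 1 ≤ i / k := (Nat.le_div_iff_mul_le hk0).2 (by rw [mul_comm]; exact hii)
          have h2 := hTmono h1
          rw [hTs] at h2
          have h3 : (0 : ℝ) ≤ i := i.cast_nonneg
          have h5 : τ i = T (i / k) + i := rfl
          refine le_trans ?_ (le_abs_self _)
          linarith [hp'.1]
      · intro c hc1 hc2
        refine (Finset.sum_le_card_nsmul _ _ (3 / 2 * T j) fun p hp => ?_).trans ?_
        · rcases Finset.mem_union.1 hp with hp | hp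
          · obtain ⟨i, hi, rfl⟩ := Finset.mem_image.1 hp
            have hi := Finset.mem_range.1 hi
            have : (i : ℝ) ≤ n := by exact_mod_cast (by omega : i ≤ n)
            have hi0 : (0 : ℝ) ≤ i := i.cast_nonneg
            rw [abs_le]
            constructor <;> linarith
          · obtain ⟨i, hi, rfl⟩ := Finset.mem_image.1 hp
            have := hclose c hc1 hc2 i (Finset.mem_range.1 hi)
            linarith
        · rw [hcard, nsmul_eq_mul]
          refine mul_le_mul_of_nonneg_right ?_ (by linarith)
          exact_mod_cast (by omega : n - m - k * (j + 1) + k * (j + 1) ≤ n)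
      · have hsub : (Finset.Ico (k * j) (k * (j + 1))).image τ ⊆
            cl (n - m - k * (j + 1)) ∪ tl (k * (j + 1)) := by
          refine Finset.Subset.trans (Finset.image_subset_image fun i hi => ?_)
            Finset.subset_union_right
          exact Finset.mem_range.2 (Finset.mem_Ico.1 hi).2
        refine lt_of_lt_of_le ?_ (Finset.sum_le_sum_of_subset_of_nonneg hsub
          fun p _ _ => secondDiff_nonneg)
        refine lt_of_lt_of_le ?_ (Finset.card_nsmul_le_sum _ _ (T j / 4) fun p hp => ?_)
        · rw [Finset.card_image_of_injective _ hτ.injective, Nat.card_Ico, nsmul_eq_mul,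
            show k * (j + 1) - k * j = k by rw [mul_add, mul_one]; omega]
          have hT : 0 < T j := by linarith
          nlinarith
        · obtain ⟨i, hi, rfl⟩ := Finset.mem_image.1 hp
          obtain ⟨h1, h2⟩ := Finset.mem_Ico.1 hi
          have hij : i / k = j := Nat.div_eq_of_lt_le (by rw [mul_comm]; exact h1)
            (by rw [mul_comm]; exact h2)
          have h3 : (i : ℝ) ≤ m := by exact_mod_cast (h2.le.trans hjm)
          have h5 : τ i = T j + i := by simp only [τ, hij]
          refine le_trans ?_ le_secondDiff
          rw [h5, add_sub_cancel_left, abs_of_nonneg i.cast_nonneg]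
          linarith
  have hcount : (m : ℝ) < k * (q + 1) := by exact_mod_cast hqm'
  have hqS : (q : ℝ) ≤ S.card := by exact_mod_cast key
  have h1 : (m : ℝ) ≤ 25 * (S.card + 1) * (n * ε) := by
    calc (m : ℝ) ≤ k * (q + 1) := hcount.le
      _ ≤ 25 * (ε * n) * (S.card + 1) := by gcongr
      _ = _ := by ring
  rw [← div_eq_mul_inv, div_div, div_le_iff₀ (by positivity)]
  exact h1

theorem rpow_neg_half_eq {ε : ℝ} (hε : 0 < ε) : ε ^ (-(1 / 2) : ℝ) = (√ε)⁻¹ := by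
  rw [Real.rpow_neg hε.le, Real.sqrt_eq_rpow]

theorem exists_forall_coresetRate_le_card {n m : ℕ} {ε : ℝ} (hmn : 4 * m ≤ n) (hε : 0 < ε)
    (hε1 : ε < 1) (hn : 1 < ε * n) :
    ∃ X : Finset ℝ, X.card = n ∧ ∀ (S : Finset ℝ) (w : ℝ → ℝ), PreservesRobustCost m ε X S w →
      1 / 100 * coresetRate n m ε ≤ S.card := by
  have hS : ∀ (X S : Finset ℝ) (w : ℝ → ℝ), X.card = n → PreservesRobustCost m ε X S w →
      (1 : ℝ) ≤ S.card := by
    intro X S w hX h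
    have hne : S.Nonempty := by
      by_contra he
      rw [Finset.not_nonempty_iff_eq_empty] at he
      have := h.total_weight
      rw [he, Finset.sum_empty, hX] at this
      rw [← this] at hn
      linarith
    exact_mod_cast hne.card_pos
  unfold coresetRate
  rw [rpow_neg_half_eq hε]
  rcases le_total ((m : ℝ) / n * ε⁻¹) (√ε)⁻¹ with hle | hle
  · obtain ⟨X, hX, h⟩ := exists_forall_inv_sqrt_le_card hmn hε hε1 hn
    refine ⟨X, hX, fun S w hw => ?_⟩
    have := h S w hw
    have := hS X S w hX hw
    linarith
  · obtain ⟨X, hX, h⟩ := exists_forall_div_le_card hmn hε hn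
    refine ⟨X, hX, fun S w hw => ?_⟩
    have := h S w hw
    have := hS X S w hX hw
    linarith

/-! ### Buckets with mean-preserving weights -/

theorem interp_nonneg {θ a b y : ℝ} (h0 : 0 ≤ θ) (h1 : θ ≤ 1) :
    |((1 - θ) * a + θ * b) - y| ≤ (1 - θ) * |a - y| + θ * |b - y| := by
  rw [show ((1 - θ) * a + θ * b) - y = (1 - θ) * (a - y) + θ * (b - y) by ring]
  refine (abs_add_le _ _).trans_eq ?_
  rw [abs_mul, abs_mul, abs_of_nonneg h0, abs_of_nonneg (sub_nonneg.2 h1)]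

theorem interp_eq {θ a b y : ℝ} (h0 : 0 ≤ θ) (h1 : θ ≤ 1) (hab : a ≤ b) (hy : y ≤ a ∨ b ≤ y) :
    (1 - θ) * |a - y| + θ * |b - y| = |((1 - θ) * a + θ * b) - y| := by
  have e1 : ((1 - θ) * a + θ * b) - y = (1 - θ) * (a - y) + θ * (b - y) := by ring
  rw [e1]
  have h1' := sub_nonneg.2 h1
  rcases hy with h | h
  · have h2 : 0 ≤ a - y := by linarith
    have h3 : 0 ≤ b - y := by linarith
    rw [abs_of_nonneg h2, abs_of_nonneg h3, abs_of_nonneg (by positivity)]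
  · have h2 : 0 ≤ y - a := by linarith
    have h3 : 0 ≤ y - b := by linarith
    have h4 : 0 ≤ (1 - θ) * (y - a) + θ * (y - b) := by positivity
    rw [abs_of_nonpos (by linarith), abs_of_nonpos (by linarith), abs_of_nonpos (by linarith)]
    ring

theorem interp_le {θ a b y : ℝ} (h0 : 0 ≤ θ) (h1 : θ ≤ 1) (hay : a ≤ y) (hyb : y ≤ b) :
    (1 - θ) * |a - y| + θ * |b - y| - |((1 - θ) * a + θ * b) - y| ≤ 2 * (y - a) ∧
    (1 - θ) * |a - y| + θ * |b - y| - |((1 - θ) * a + θ * b) - y| ≤ 2 * (b - y) := by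
  rw [abs_of_nonpos (by linarith : a - y ≤ 0), abs_of_nonneg (by linarith : 0 ≤ b - y)]
  have h2 := le_abs_self (((1 - θ) * a + θ * b) - y)
  have h3 := neg_le_abs (((1 - θ) * a + θ * b) - y)
  constructor
  · nlinarith [mul_nonneg h0 (sub_nonneg.2 hay)]
  · nlinarith [mul_nonneg (sub_nonneg.2 h1) (sub_nonneg.2 hyb)]

/-- The sum of the distances of the points with indices `s, …, e` to the point with index `s`. -/
noncomputable def bucketSum (p : ℕ → ℝ) (s e : ℕ) : ℝ :=
  ∑ i ∈ Finset.Ico s (e + 1), (p i - p s)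

/-- The weights carried by the bucket of the points with indices `s, …, e`: only its endpoints have
nonzero weight, and both the total weight and the weighted mean are those of the bucket. A quotient
by zero gives the weight `1` when `s = e`. -/
noncomputable def bucketWeight (p : ℕ → ℝ) (s e i : ℕ) : ℝ :=
  if i = s then ((e : ℝ) - s + 1) - bucketSum p s e / (p e - p s)
  else if i = e then bucketSum p s e / (p e - p s) else 0

theorem sum_bucketWeight_mul {p : ℕ → ℝ} {s e : ℕ} (hse : s ≤ e) (g : ℕ → ℝ) :
    ∑ i ∈ Finset.Ico s (e + 1), bucketWeight p s e i * g i =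
      ∑ i ∈ Finset.Ico s (e + 1),
        ((1 - (p i - p s) / (p e - p s)) * g s + (p i - p s) / (p e - p s) * g e) := by
  rcases hse.eq_or_lt with rfl | hlt
  · simp [bucketWeight]
  · have h1 : ∀ i, bucketWeight p s e i * g i =
        (if i = s then (((e : ℝ) - s + 1) - bucketSum p s e / (p e - p s)) * g s else 0) +
        (if i = e then bucketSum p s e / (p e - p s) * g e else 0) := by
      intro i
      unfold bucketWeight
      by_cases his : i = s
      · subst his; simp [hlt.ne]
      · by_cases hie : i = e
        · subst hie; simp [his]
        · simp [his, hie]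
    rw [Finset.sum_congr rfl fun i _ => h1 i, Finset.sum_add_distrib, Finset.sum_ite_eq',
      Finset.sum_ite_eq', if_pos (Finset.mem_Ico.2 ⟨le_rfl, by omega⟩),
      if_pos (Finset.mem_Ico.2 ⟨hse, by omega⟩), Finset.sum_add_distrib, ← Finset.sum_mul,
      ← Finset.sum_mul, Finset.sum_sub_distrib, ← Finset.sum_div, bucketSum, Finset.sum_const,
      Nat.card_Ico, nsmul_eq_mul, mul_one, Nat.cast_sub (by omega)]
    push_cast
    ring

section Bucket

variable {n : ℕ} {p : ℕ → ℝ} {s e : ℕ}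

theorem interp_param (hp : StrictMonoOn p (Set.Iio n)) (he : e < n) {i : ℕ}
    (hi : i ∈ Finset.Ico s (e + 1)) :
    0 ≤ (p i - p s) / (p e - p s) ∧ (p i - p s) / (p e - p s) ≤ 1 ∧
      p i = (1 - (p i - p s) / (p e - p s)) * p s + (p i - p s) / (p e - p s) * p e := by
  obtain ⟨h1, h2⟩ := Finset.mem_Ico.1 hi
  have hie : i ≤ e := by omega
  have h3 : p s ≤ p i := hp.monotoneOn (Set.mem_Iio.2 (by omega)) (Set.mem_Iio.2 (by omega)) h1
  have h4 : p i ≤ p e := hp.monotoneOn (Set.mem_Iio.2 (by omega)) (Set.mem_Iio.2 (by omega)) hie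
  rcases (h3.trans h4).eq_or_lt with h | h
  · have : p i = p s := by linarith
    simp [this]
  · have h5 : 0 < p e - p s := by linarith
    refine ⟨by apply div_nonneg <;> linarith, (div_le_one h5).2 (by linarith), ?_⟩
    field_simp
    ring

theorem bucketWeight_nonneg (hp : StrictMonoOn p (Set.Iio n)) (he : e < n) (hse : s ≤ e) (i : ℕ) :
    0 ≤ bucketWeight p s e i := by
  have hT : bucketSum p s e / (p e - p s) =
      ∑ i ∈ Finset.Ico s (e + 1), (p i - p s) / (p e - p s) := by
    rw [bucketSum, Finset.sum_div]
  have h0 : 0 ≤ bucketSum p s e / (p e - p s) := by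
    rw [hT]; exact Finset.sum_nonneg fun i hi => (interp_param hp he hi).1
  have h1 : bucketSum p s e / (p e - p s) ≤ (e : ℝ) - s + 1 := by
    rw [hT]
    refine (Finset.sum_le_card_nsmul _ _ 1 fun i hi => (interp_param hp he hi).2.1).trans ?_
    rw [Nat.card_Ico, nsmul_eq_mul, mul_one, Nat.cast_sub (by omega)]
    push_cast
    linarith
  unfold bucketWeight
  split_ifs <;> linarith

theorem sum_bucketWeight (hse : s ≤ e) :
    ∑ i ∈ Finset.Ico s (e + 1), bucketWeight p s e i = (e : ℝ) + 1 - s := by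
  have := sum_bucketWeight_mul (p := p) hse fun _ => 1
  simp only [mul_one, sub_add_cancel] at this
  rw [this, Finset.sum_const, Nat.card_Ico, nsmul_eq_mul, mul_one, Nat.cast_sub (by omega)]
  push_cast
  ring

theorem bucketError_eq (hp : StrictMonoOn p (Set.Iio n)) (he : e < n) (hse : s ≤ e) (y : ℝ) :
    ∑ i ∈ Finset.Ico s (e + 1), (bucketWeight p s e i - 1) * |p i - y| =
      ∑ i ∈ Finset.Ico s (e + 1), ((1 - (p i - p s) / (p e - p s)) * |p s - y| +
        (p i - p s) / (p e - p s) * |p e - y| -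
        |((1 - (p i - p s) / (p e - p s)) * p s + (p i - p s) / (p e - p s) * p e) - y|) := by
  simp only [sub_mul _ (1 : ℝ) |_|, one_mul, Finset.sum_sub_distrib]
  rw [sum_bucketWeight_mul hse fun i => |p i - y|]
  congr 1
  exact Finset.sum_congr rfl fun i hi => by rw [← (interp_param hp he hi).2.2]

theorem bucketError_eq_zero (hp : StrictMonoOn p (Set.Iio n)) (he : e < n) (hse : s ≤ e) {y : ℝ}
    (hy : y ≤ p s ∨ p e ≤ y) :
    ∑ i ∈ Finset.Ico s (e + 1), (bucketWeight p s e i - 1) * |p i - y| = 0 := by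
  rw [bucketError_eq hp he hse]
  refine Finset.sum_eq_zero fun i hi => ?_
  obtain ⟨h0, h1, -⟩ := interp_param hp he hi
  rw [interp_eq h0 h1 (hp.monotoneOn (Set.mem_Iio.2 (by omega)) (Set.mem_Iio.2 he) hse) hy,
    sub_self]

theorem bucketError_nonneg (hp : StrictMonoOn p (Set.Iio n)) (he : e < n) (hse : s ≤ e) (y : ℝ) :
    0 ≤ ∑ i ∈ Finset.Ico s (e + 1), (bucketWeight p s e i - 1) * |p i - y| := by
  rw [bucketError_eq hp he hse]
  refine Finset.sum_nonneg fun i hi => ?_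
  obtain ⟨h0, h1, -⟩ := interp_param hp he hi
  exact sub_nonneg.2 (interp_nonneg h0 h1)

theorem bucketError_le (hp : StrictMonoOn p (Set.Iio n)) (he : e < n) (hse : s ≤ e) {y : ℝ}
    (h1 : p s ≤ y) (h2 : y ≤ p e) :
    ∑ i ∈ Finset.Ico s (e + 1), (bucketWeight p s e i - 1) * |p i - y| ≤
      2 * ((e : ℝ) + 1 - s) * min (y - p s) (p e - y) := by
  rw [bucketError_eq hp he hse]
  refine (Finset.sum_le_card_nsmul _ _ (2 * min (y - p s) (p e - y)) fun i hi => ?_).trans ?_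
  · obtain ⟨h3, h4, -⟩ := interp_param hp he hi
    obtain ⟨h5, h6⟩ := interp_le h3 h4 h1 h2
    rw [mul_min_of_nonneg _ _ zero_le_two]
    exact le_min h5 h6
  · rw [Nat.card_Ico, nsmul_eq_mul, Nat.cast_sub (by omega)]
    push_cast
    exact le_of_eq (by ring)

/-- The weights `W` on the indices below `N` come from cutting these indices into buckets, each of
which satisfies `V` unless it is a single point. This is recorded through the consequences that
matter: total weight, and the fact that the error in the sum of distances to `y` is the error of the
one bucket whose open hull contains `y`. -/
structure Bucketed (p : ℕ → ℝ) (V : ℕ → ℕ → Prop) (N : ℕ) (W : ℕ → ℝ) : Prop where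
  nonneg : ∀ i < N, 0 ≤ W i
  sum_eq : ∑ i ∈ Finset.range N, W i = N
  error : ∀ y, ∑ i ∈ Finset.range N, (W i - 1) * |p i - y| = 0 ∨
    ∃ s e, s < e ∧ e < N ∧ V s e ∧ p s < y ∧ y < p e ∧
      0 ≤ ∑ i ∈ Finset.range N, (W i - 1) * |p i - y| ∧
      ∑ i ∈ Finset.range N, (W i - 1) * |p i - y| ≤
        2 * ((e : ℝ) + 1 - s) * min (y - p s) (p e - y)

theorem Bucketed.zero (p : ℕ → ℝ) (V : ℕ → ℕ → Prop) (W : ℕ → ℝ) : Bucketed p V 0 W :=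
  ⟨by simp, by simp, by simp⟩

theorem Bucketed.congr {V : ℕ → ℕ → Prop} {N : ℕ} {W W' : ℕ → ℝ} (h : Bucketed p V N W)
    (hW : ∀ i < N, W' i = W i) : Bucketed p V N W' := by
  have h1 : ∀ y, ∑ i ∈ Finset.range N, (W' i - 1) * |p i - y| =
      ∑ i ∈ Finset.range N, (W i - 1) * |p i - y| := fun y =>
    Finset.sum_congr rfl fun i hi => by rw [hW i (Finset.mem_range.1 hi)]
  refine ⟨fun i hi => by rw [hW i hi]; exact h.nonneg i hi, ?_, fun y => ?_⟩
  · rw [← h.sum_eq]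
    exact Finset.sum_congr rfl fun i hi => by rw [hW i (Finset.mem_range.1 hi)]
  · rw [h1]; exact h.error y

/-- Closing a bucket. -/
theorem Bucketed.append {V : ℕ → ℕ → Prop} {W : ℕ → ℝ} (hp : StrictMonoOn p (Set.Iio n))
    (h : Bucketed p V s W) (hse : s ≤ e) (he : e < n) (hV : s < e → V s e)
    (hW : ∀ i, s ≤ i → i ≤ e → W i = bucketWeight p s e i) : Bucketed p V (e + 1) W := by
  have hsplit : ∀ f : ℕ → ℝ, ∑ i ∈ Finset.range (e + 1), f i =
      ∑ i ∈ Finset.range s, f i + ∑ i ∈ Finset.Ico s (e + 1), f i := fun f =>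
    (Finset.sum_range_add_sum_Ico f (by omega)).symm
  have hlt : ∀ {i j}, i < j → j < n → p i < p j := fun hij hj =>
    hp (Set.mem_Iio.2 (by omega)) (Set.mem_Iio.2 hj) hij
  refine ⟨fun i hi => ?_, ?_, fun y => ?_⟩
  · rcases lt_or_ge i s with his | his
    · exact h.nonneg i his
    · rw [hW i his (by omega)]
      exact bucketWeight_nonneg hp he hse i
  · rw [hsplit, h.sum_eq, Finset.sum_congr rfl fun i hi => hW i (Finset.mem_Ico.1 hi).1
      (by have := (Finset.mem_Ico.1 hi).2; omega), sum_bucketWeight hse]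
    push_cast
    ring
  · have hb : ∑ i ∈ Finset.Ico s (e + 1), (W i - 1) * |p i - y| =
        ∑ i ∈ Finset.Ico s (e + 1), (bucketWeight p s e i - 1) * |p i - y| :=
      Finset.sum_congr rfl fun i hi => by
        rw [hW i (Finset.mem_Ico.1 hi).1 (by have := (Finset.mem_Ico.1 hi).2; omega)]
    rw [hsplit, hb]
    rcases h.error y with h0 | ⟨s', e', h1, h2, h3, h4, h5, h6, h7⟩
    · rw [h0, zero_add]
      by_cases hy : y ≤ p s ∨ p e ≤ y
      · exact Or.inl (bucketError_eq_zero hp he hse hy)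
      · rw [not_or, not_le, not_le] at hy
        have hse' : s < e := by
          rcases hse.eq_or_lt with rfl | hlt
          · exact absurd (hy.1.trans hy.2) (lt_irrefl _)
          · exact hlt
        exact Or.inr ⟨s, e, hse', by omega, hV hse', hy.1, hy.2,
          bucketError_nonneg hp he hse y, bucketError_le hp he hse hy.1.le hy.2.le⟩
    · rw [bucketError_eq_zero hp he hse (Or.inl (h5.trans (hlt h2 (by omega))).le), add_zero]
      exact Or.inr ⟨s', e', h1, by omega, h3, h4, h5, h6, h7⟩

end Bucket

/-! ### The bucketing rule and the number of buckets -/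

/-- The data steering the bucketing of the points `p 0 < ⋯ < p (n - 1)`: the median `p h`, the
window of `n - m` consecutive indices starting at `i₀` that is nearest to the median, and the sum
`Q` of the distances of this window to the median. -/
structure WindowData (n m h i₀ : ℕ) (p : ℕ → ℝ) (Q : ℝ) : Prop where
  one_le : 1 ≤ m
  four_mul_le : 4 * m ≤ n
  mono : StrictMonoOn p (Set.Iio n)
  two_mul_le : 2 * h ≤ n
  le_two_mul : n ≤ 2 * h + 1
  start_le : i₀ ≤ m
  left : ∀ i < i₀, p (i + (n - m)) - p h < p h - p i
  right : i₀ < m → p h - p i₀ ≤ p (i₀ + (n - m)) - p h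
  Q_eq : Q = ∑ i ∈ Finset.Ico i₀ (i₀ + (n - m)), |p i - p h|

/-- The first or last `m` indices, the only ones that can be outliers. -/
def IsTail (n m j : ℕ) : Prop := j < m ∨ n - m ≤ j

/-- The points with indices `s, …, j` are too many, or too spread out, to form one bucket. When `s`
and `j` are on the same side of the median, `|p j + p s - 2 * p h|` is the sum of their distances to
it. -/
def Violates (n m h : ℕ) (p : ℕ → ℝ) (δ Q : ℝ) (s j : ℕ) : Prop :=
  (IsTail n m j ∧ δ * n < (j : ℝ) - s) ∨
    (¬ IsTail n m j ∧ δ * (Q + n * |p j + p s - 2 * p h|) < ((j : ℝ) - s) * (p j - p s))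

/-- The indices at which a new bucket is always started. -/
def cuts (n m h i₀ : ℕ) : Finset ℕ := {m, n - m, h, i₀, i₀ + (n - m)}

/-- The points with indices `s, …, e` may form one bucket. -/
def IsValid (n m h i₀ : ℕ) (p : ℕ → ℝ) (δ Q : ℝ) (s e : ℕ) : Prop :=
  (∀ f ∈ cuts n m h i₀, ¬ (s < f ∧ f ≤ e)) ∧ ¬ Violates n m h p δ Q s e

theorem isValid_cut {n m h i₀ s e : ℕ}
    (hV : ∀ f ∈ cuts n m h i₀, ¬ (s < f ∧ f ≤ e)) :
    (e < m ∨ m ≤ s) ∧ (e < n - m ∨ n - m ≤ s) ∧ (e < h ∨ h ≤ s) ∧ (e < i₀ ∨ i₀ ≤ s) ∧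
      (e < i₀ + (n - m) ∨ i₀ + (n - m) ≤ s) := by
  simp only [cuts, Finset.mem_insert, Finset.mem_singleton, forall_eq_or_imp, forall_eq] at hV
  omega

/-- The mass that the index `i` contributes to `potential`. -/
noncomputable def potentialMass (n m h : ℕ) (p : ℕ → ℝ) (δ Q : ℝ) (i : ℕ) : ℝ :=
  open Classical in
  if IsTail n m i then 1 / (δ * n) else (Q + n * |p i - p h|) / (n * Q) / (2 * √δ)

theorem potentialMass_of_isTail {n m h i : ℕ} {p : ℕ → ℝ} {δ Q : ℝ} (hi : IsTail n m i) :
    potentialMass n m h p δ Q i = 1 / (δ * n) := if_pos hi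

/-- A bounded increasing function whose slope at distance `y` from the median is `n * Q` divided by
the square of `Q + n * y`. -/
noncomputable def ramp (n : ℕ) (Q u : ℝ) : ℝ := n * u / (Q + n * |u|)

/-- A bounded function of the index that increases by at least `1` over every bucket that was closed
because the next point violates the bucketing rule. -/
noncomputable def potential (n m h : ℕ) (p : ℕ → ℝ) (δ Q : ℝ) (j : ℕ) : ℝ :=
  ∑ i ∈ Finset.range j, potentialMass n m h p δ Q i + ramp n Q (p j - p h) / (2 * √δ)

theorem ramp_mono {n : ℕ} {Q u v : ℝ} (hQ : 0 < Q) (huv : u ≤ v) : ramp n Q u ≤ ramp n Q v := by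
  have hn : (0 : ℝ) ≤ n := n.cast_nonneg
  have h1 : 0 < Q + n * |u| := by positivity
  have h2 : 0 < Q + n * |v| := by positivity
  unfold ramp
  rw [div_le_div_iff₀ h1 h2]
  have key : u * |v| ≤ v * |u| := by
    rcases abs_cases u with ⟨e1, f1⟩ | ⟨e1, f1⟩ <;> rcases abs_cases v with ⟨e2, f2⟩ | ⟨e2, f2⟩ <;>
      rw [e1, e2] <;> nlinarith
  have k1 := mul_le_mul_of_nonneg_left key (mul_nonneg hn hn)
  have k2 := mul_le_mul_of_nonneg_left huv (mul_nonneg hn hQ.le)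
  linarith

theorem abs_ramp_le {n : ℕ} {Q u : ℝ} (hQ : 0 < Q) : |ramp n Q u| ≤ 1 := by
  have hn : (0 : ℝ) ≤ n := n.cast_nonneg
  unfold ramp
  rw [abs_div, abs_mul, abs_of_nonneg hn, abs_of_nonneg (by positivity : 0 ≤ Q + n * |u|)]
  exact div_le_one_of_le₀ (by linarith) (by positivity)

theorem ramp_sub {n : ℕ} {Q u v : ℝ} (hQ : 0 < Q) (h : (0 ≤ u ∧ 0 ≤ v) ∨ (u ≤ 0 ∧ v ≤ 0)) :
    ramp n Q v - ramp n Q u = n * Q * (v - u) / ((Q + n * |u|) * (Q + n * |v|)) := by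
  have hn : (0 : ℝ) ≤ n := n.cast_nonneg
  have h1 : Q + n * |u| ≠ 0 := by positivity
  have h2 : Q + n * |v| ≠ 0 := by positivity
  unfold ramp
  rw [div_sub_div _ _ h2 h1, mul_comm (Q + n * |v|) (Q + n * |u|)]
  congr 1
  rcases h with ⟨hu, hv⟩ | ⟨hu, hv⟩
  · rw [abs_of_nonneg hu, abs_of_nonneg hv]; ring
  · rw [abs_of_nonpos hu, abs_of_nonpos hv]; ring

theorem two_sqrt_le_add {a b δ : ℝ} (ha : 0 ≤ a) (hb : 0 ≤ b) (h : δ ≤ a * b) :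
    2 * √δ ≤ a + b := by
  have : √δ ≤ (a + b) / 2 := Real.sqrt_le_iff.2 ⟨by linarith, by nlinarith [sq_nonneg (a - b)]⟩
  linarith

namespace WindowData

variable {n m h i₀ : ℕ} {p : ℕ → ℝ} {Q : ℝ}

theorem le_of_le (D : WindowData n m h i₀ p Q) {i j : ℕ} (hij : i ≤ j) (hj : j < n) : p i ≤ p j :=
  D.mono.monotoneOn (Set.mem_Iio.2 (by omega)) (Set.mem_Iio.2 hj) hij

theorem lt_of_lt (D : WindowData n m h i₀ p Q) {i j : ℕ} (hij : i < j) (hj : j < n) : p i < p j :=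
  D.mono (Set.mem_Iio.2 (by omega)) (Set.mem_Iio.2 hj) hij

theorem n_pos (D : WindowData n m h i₀ p Q) : (0 : ℝ) < n := by
  have := D.one_le
  have := D.four_mul_le
  exact_mod_cast (by omega : 0 < n)

theorem Q_pos (D : WindowData n m h i₀ p Q) : 0 < Q := by
  have h1 := D.one_le
  have h2 := D.four_mul_le
  have h3 := D.start_le
  rw [D.Q_eq]
  refine Finset.sum_pos' (fun i _ => abs_nonneg _) ?_
  have hne : ∀ i, i < n → i ≠ h → 0 < |p i - p h| := fun i hi hih => by
    rw [abs_pos, sub_ne_zero]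
    exact fun he => hih (D.mono.injOn (Set.mem_Iio.2 hi)
      (Set.mem_Iio.2 (by have := D.two_mul_le; omega)) he)
  by_cases hi : i₀ = h
  · exact ⟨i₀ + 1, Finset.mem_Ico.2 ⟨by omega, by omega⟩, hne _ (by omega) (by omega)⟩
  · exact ⟨i₀, Finset.mem_Ico.2 ⟨by omega, by omega⟩, hne _ (by omega) hi⟩

theorem potentialMass_nonneg (D : WindowData n m h i₀ p Q) {δ : ℝ} (hδ : 0 < δ) (i : ℕ) :
    0 ≤ potentialMass n m h p δ Q i := by
  have := D.n_pos
  have := D.Q_pos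
  unfold potentialMass
  split_ifs <;> positivity

theorem potential_mono (D : WindowData n m h i₀ p Q) {δ : ℝ} (hδ : 0 < δ) {s j : ℕ} (hsj : s ≤ j)
    (hj : j < n) : potential n m h p δ Q s ≤ potential n m h p δ Q j := by
  unfold potential
  have h1 : ∑ i ∈ Finset.range s, potentialMass n m h p δ Q i ≤
      ∑ i ∈ Finset.range j, potentialMass n m h p δ Q i :=
    Finset.sum_le_sum_of_subset_of_nonneg (Finset.range_subset_range.2 hsj)
      fun i _ _ => D.potentialMass_nonneg hδ i
  have h2 : ramp n Q (p s - p h) ≤ ramp n Q (p j - p h) :=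
    ramp_mono D.Q_pos (sub_le_sub_right (D.le_of_le hsj hj) _)
  have h3 : 0 < 2 * √δ := by positivity
  have := div_le_div_of_nonneg_right h2 h3.le
  linarith

/-- In the middle part, the rule being violated means that the increments of the two terms of the
potential, without their common factor `1 / (2 * √δ)`, have a product of at least `δ`; the
inequality between arithmetic and geometric means then bounds their sum from below. -/
theorem potential_step (D : WindowData n m h i₀ p Q) {δ : ℝ} (hδ : 0 < δ) {s j : ℕ} (hsj : s < j)
    (hj : j < n) (hcut : ∀ f ∈ cuts n m h i₀, ¬ (s < f ∧ f ≤ j)) (hv : Violates n m h p δ Q s j) :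
    potential n m h p δ Q s + 1 ≤ potential n m h p δ Q j := by
  obtain ⟨c1, c2, c3, -⟩ := isValid_cut hcut
  have hn := D.n_pos
  have hQ := D.Q_pos
  have hs0 : 0 < √δ := Real.sqrt_pos.2 hδ
  have hsum : ∑ i ∈ Finset.range j, potentialMass n m h p δ Q i =
      ∑ i ∈ Finset.range s, potentialMass n m h p δ Q i +
        ∑ i ∈ Finset.Ico s j, potentialMass n m h p δ Q i :=
    (Finset.sum_range_add_sum_Ico _ hsj.le).symm
  have hcard : ((Finset.Ico s j).card : ℝ) = (j : ℝ) - s := by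
    rw [Nat.card_Ico, Nat.cast_sub hsj.le]
  have hjs : (0 : ℝ) < (j : ℝ) - s := by
    have : (s : ℝ) < j := by exact_mod_cast hsj
    linarith
  unfold potential
  rw [hsum]
  rcases hv with ⟨ht, hv⟩ | ⟨ht, hv⟩
  · have h1 : ∑ i ∈ Finset.Ico s j, potentialMass n m h p δ Q i =
        ((j : ℝ) - s) * (1 / (δ * n)) := by
      rw [← hcard, ← nsmul_eq_mul, ← Finset.sum_const]
      refine Finset.sum_congr rfl fun i hi => if_pos ?_
      have := Finset.mem_Ico.1 hi
      unfold IsTail at ht ⊢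
      omega
    have h2 : 1 ≤ ((j : ℝ) - s) * (1 / (δ * n)) := by
      rw [mul_one_div, one_le_div (by positivity)]
      exact hv.le
    have h3 : ramp n Q (p s - p h) ≤ ramp n Q (p j - p h) :=
      ramp_mono hQ (sub_le_sub_right (D.le_of_le hsj.le hj) _)
    have := div_le_div_of_nonneg_right h3 (by positivity : 0 ≤ 2 * √δ)
    linarith
  · set A := ∑ i ∈ Finset.Ico s j, (Q + n * |p i - p h|) / (n * Q) with hA
    have h1 : ∑ i ∈ Finset.Ico s j, potentialMass n m h p δ Q i = A / (2 * √δ) := by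
      rw [hA, Finset.sum_div]
      refine Finset.sum_congr rfl fun i hi => if_neg ?_
      have := Finset.mem_Ico.1 hi
      unfold IsTail at ht ⊢
      omega
    have hlt := D.lt_of_lt hsj hj
    set u := p s - p h with hu
    set v := p j - p h with hv'
    have hside : (0 ≤ u ∧ 0 ≤ v) ∨ (u ≤ 0 ∧ v ≤ 0) := by
      rcases c3 with c | c
      · right
        have := D.two_mul_le
        have := D.one_le
        have := D.four_mul_le
        have := D.le_of_le c.le (by omega)
        constructor <;> linarith
      · left
        have := D.le_of_le c (by omega)
        constructor <;> linarith
    have hB := ramp_sub (n := n) hQ hside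
    set B := ramp n Q v - ramp n Q u with hBdef
    have hvu : v - u = p j - p s := by rw [hu, hv']; ring
    have habs : |p j + p s - 2 * p h| = |u| + |v| := by
      rw [show p j + p s - 2 * p h = u + v by rw [hu, hv']; ring]
      rcases hside with ⟨a, b⟩ | ⟨a, b⟩
      · rw [abs_of_nonneg a, abs_of_nonneg b, abs_of_nonneg (add_nonneg a b)]
      · rw [abs_of_nonpos a, abs_of_nonpos b, abs_of_nonpos (add_nonpos a b)]; ring
    rw [habs] at hv
    have hU : 0 < Q + n * |u| := by positivity
    have hV : 0 < Q + n * |v| := by positivity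
    have hB0 : 0 ≤ B := by
      rw [hB, hvu]
      have : 0 < p j - p s := by linarith
      positivity
    have hA1 : ((j : ℝ) - s) * ((Q + n * min |u| |v|) / (n * Q)) ≤ A := by
      rw [← hcard, ← nsmul_eq_mul]
      refine Finset.card_nsmul_le_sum _ _ _ fun i hi => ?_
      obtain ⟨i1, i2⟩ := Finset.mem_Ico.1 hi
      have g1 := D.le_of_le i1 (by omega)
      have g2 := D.le_of_le i2.le hj
      have : min |u| |v| ≤ |p i - p h| := by
        rcases hside with ⟨a, b⟩ | ⟨a, b⟩
        · refine (min_le_left _ _).trans ?_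
          rw [abs_of_nonneg a, abs_of_nonneg (by linarith)]
          linarith
        · refine (min_le_right _ _).trans ?_
          rw [abs_of_nonpos b, abs_of_nonpos (by linarith)]
          linarith
      gcongr
    have hA0 : 0 ≤ A := le_trans (by positivity) hA1
    have hmul : (Q + n * min |u| |v|) * (Q + n * max |u| |v|) = (Q + n * |u|) * (Q + n * |v|) := by
      rcases le_total |u| |v| with hle | hle
      · rw [min_eq_left hle, max_eq_right hle]
      · rw [min_eq_right hle, max_eq_left hle, mul_comm]
    have hmax : max |u| |v| ≤ |u| + |v| :=
      max_le (by linarith [abs_nonneg v]) (by linarith [abs_nonneg u])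
    have hmin0 : 0 ≤ min |u| |v| := le_min (abs_nonneg _) (abs_nonneg _)
    have hAB : δ ≤ A * B := by
      refine le_trans ?_ (mul_le_mul_of_nonneg_right hA1 hB0)
      rw [hB, hvu, ← hmul]
      have hP : 0 < Q + n * min |u| |v| := by positivity
      have hM : 0 < Q + n * max |u| |v| := by
        have : 0 ≤ max |u| |v| := le_max_of_le_left (abs_nonneg _)
        positivity
      have : ((j : ℝ) - s) * ((Q + n * min |u| |v|) / (n * Q)) *
          (n * Q * (p j - p s) / ((Q + n * min |u| |v|) * (Q + n * max |u| |v|))) =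
          ((j : ℝ) - s) * (p j - p s) / (Q + n * max |u| |v|) := by
        field_simp
      rw [this, le_div_iff₀ hM]
      refine le_trans ?_ hv.le
      gcongr
    have hfin := two_sqrt_le_add hA0 hB0 hAB
    have h4 : 1 ≤ (A + B) / (2 * √δ) := by rwa [one_le_div (by positivity)]
    rw [h1]
    have h5 : (A + B) / (2 * √δ) = A / (2 * √δ) + ramp n Q v / (2 * √δ) -
        ramp n Q u / (2 * √δ) := by
      rw [hBdef]; ring
    linarith

theorem potential_sub_le (D : WindowData n m h i₀ p Q) {δ : ℝ} (hδ : 0 < δ) {s : ℕ} (hs : s < n) :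
    potential n m h p δ Q s - potential n m h p δ Q 0 ≤ 2 * m / (δ * n) + 2 / √δ := by
  have hn := D.n_pos
  have hQ := D.Q_pos
  have hs0 : 0 < √δ := Real.sqrt_pos.2 hδ
  have hm4 := D.four_mul_le
  have hi₀ := D.start_le
  have h1 : ∑ i ∈ Finset.range s, potentialMass n m h p δ Q i ≤
      ∑ i ∈ Finset.range n, potentialMass n m h p δ Q i :=
    Finset.sum_le_sum_of_subset_of_nonneg (Finset.range_subset_range.2 hs.le)
      fun i _ _ => D.potentialMass_nonneg hδ i
  have h2 : ∑ i ∈ Finset.range n, potentialMass n m h p δ Q i =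
      ∑ i ∈ Finset.range m, potentialMass n m h p δ Q i +
      ∑ i ∈ Finset.Ico m (n - m), potentialMass n m h p δ Q i +
      ∑ i ∈ Finset.Ico (n - m) n, potentialMass n m h p δ Q i := by
    rw [Finset.sum_range_add_sum_Ico _ (by omega), Finset.sum_range_add_sum_Ico _ (by omega)]
  have h3 : ∑ i ∈ Finset.range m, potentialMass n m h p δ Q i = m * (1 / (δ * n)) := by
    rw [Finset.sum_congr rfl fun i hi => potentialMass_of_isTail (Or.inl (Finset.mem_range.1 hi)),
      Finset.sum_const, Finset.card_range, nsmul_eq_mul]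
  have h4 : ∑ i ∈ Finset.Ico (n - m) n, potentialMass n m h p δ Q i = m * (1 / (δ * n)) := by
    rw [Finset.sum_congr rfl fun i hi => potentialMass_of_isTail (Or.inr (Finset.mem_Ico.1 hi).1),
      Finset.sum_const, Nat.card_Ico, nsmul_eq_mul, show n - (n - m) = m by omega]
  have h5 : ∑ i ∈ Finset.Ico m (n - m), potentialMass n m h p δ Q i =
      (∑ i ∈ Finset.Ico m (n - m), (Q + n * |p i - p h|)) / (n * Q) / (2 * √δ) := by
    rw [Finset.sum_div, Finset.sum_div]
    refine Finset.sum_congr rfl fun i hi => if_neg ?_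
    have := Finset.mem_Ico.1 hi
    unfold IsTail
    omega
  have h6 : ∑ i ∈ Finset.Ico m (n - m), (Q + n * |p i - p h|) ≤ 2 * (n * Q) := by
    rw [Finset.sum_add_distrib, Finset.sum_const, ← Finset.mul_sum, nsmul_eq_mul, two_mul]
    refine add_le_add (mul_le_mul_of_nonneg_right ?_ hQ.le) (mul_le_mul_of_nonneg_left ?_ hn.le)
    · rw [Nat.card_Ico]
      exact_mod_cast (by omega : n - m - m ≤ n)
    · rw [D.Q_eq]
      refine Finset.sum_le_sum_of_subset_of_nonneg (fun i hi => ?_) fun i _ _ => abs_nonneg _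
      have := Finset.mem_Ico.1 hi
      exact Finset.mem_Ico.2 (by omega)
  have h7 : (∑ i ∈ Finset.Ico m (n - m), (Q + n * |p i - p h|)) / (n * Q) / (2 * √δ) ≤ 1 / √δ := by
    rw [div_div, div_le_div_iff₀ (by positivity) hs0]
    nlinarith
  have h8 : ramp n Q (p s - p h) / (2 * √δ) - ramp n Q (p 0 - p h) / (2 * √δ) ≤ 1 / √δ := by
    rw [← sub_div, div_le_div_iff₀ (by positivity) hs0]
    have := (abs_le.1 (abs_ramp_le (n := n) (u := p s - p h) hQ)).2
    have := (abs_le.1 (abs_ramp_le (n := n) (u := p 0 - p h) hQ)).1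
    nlinarith
  unfold potential
  rw [Finset.sum_range_zero]
  have h9 : 2 * m / (δ * n) + 2 / √δ = m * (1 / (δ * n)) + m * (1 / (δ * n)) + 1 / √δ + 1 / √δ := by
    ring
  rw [h9]
  linarith

end WindowData

/-! ### The bucketed weights form a coreset -/

namespace WindowData

variable {n m h i₀ : ℕ} {p : ℕ → ℝ} {Q : ℝ}

/-- The dataset with points `p 0, …, p (n - 1)`. -/
noncomputable def points (n : ℕ) (p : ℕ → ℝ) : Finset ℝ := (Finset.range n).image p

theorem injOn (D : WindowData n m h i₀ p Q) {s : Finset ℕ} (hs : ∀ i ∈ s, i < n) :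
    Set.InjOn p (s : Set ℕ) := fun i hi j hj hij =>
  D.mono.injOn (Set.mem_Iio.2 (hs i hi)) (Set.mem_Iio.2 (hs j hj)) hij

theorem card_image (D : WindowData n m h i₀ p Q) {s : Finset ℕ} (hs : ∀ i ∈ s, i < n) :
    (s.image p).card = s.card := Finset.card_image_of_injOn (D.injOn hs)

theorem card_points (D : WindowData n m h i₀ p Q) : (points n p).card = n := by
  rw [points, D.card_image fun i hi => Finset.mem_range.1 hi, Finset.card_range]

theorem mem_points {i : ℕ} (hi : i < n) : p i ∈ points n p :=
  Finset.mem_image_of_mem _ (Finset.mem_range.2 hi)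

/-- The `n - m` points nearest to the median. -/
noncomputable def window (n m i₀ : ℕ) (p : ℕ → ℝ) : Finset ℝ :=
  (Finset.Ico i₀ (i₀ + (n - m))).image p

/-- The distance from the median to the farthest point of the window. -/
noncomputable def radius (n m h i₀ : ℕ) (p : ℕ → ℝ) : ℝ :=
  max (p h - p i₀) (p (i₀ + (n - m) - 1) - p h)

theorem lt_of_mem_window (D : WindowData n m h i₀ p Q) {i : ℕ}
    (hi : i ∈ Finset.Ico i₀ (i₀ + (n - m))) : i < n := by
  have := D.start_le
  have := D.four_mul_le
  have := (Finset.mem_Ico.1 hi).2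
  omega

theorem window_subset (D : WindowData n m h i₀ p Q) : window n m i₀ p ⊆ points n p :=
  Finset.image_subset_image fun _ hi => Finset.mem_range.2 (D.lt_of_mem_window hi)

theorem card_window (D : WindowData n m h i₀ p Q) : (window n m i₀ p).card = n - m := by
  rw [window, D.card_image fun i hi => D.lt_of_mem_window hi, Nat.card_Ico]
  omega

theorem radius_le_left (D : WindowData n m h i₀ p Q) {i : ℕ} (hi : i < i₀) :
    radius n m h i₀ p ≤ p h - p i := by
  have := D.start_le
  have := D.four_mul_le
  have := D.one_le
  have h1 := D.left (i₀ - 1) (by omega)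
  rw [show i₀ - 1 + (n - m) = i₀ + (n - m) - 1 by omega] at h1
  have h2 := D.le_of_le (show i ≤ i₀ - 1 by omega) (by omega)
  have h3 := D.le_of_le hi.le (by omega)
  exact max_le (by linarith) (by linarith)

theorem radius_le_right (D : WindowData n m h i₀ p Q) {i : ℕ} (hi : i₀ + (n - m) ≤ i)
    (hin : i < n) : radius n m h i₀ p ≤ p i - p h := by
  have := D.start_le
  have := D.four_mul_le
  have := D.one_le
  have h1 := D.right (by omega)
  have h2 := D.le_of_le hi hin
  have h3 := D.le_of_le (show i₀ + (n - m) - 1 ≤ i by omega) hin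
  exact max_le (by linarith) (by linarith)

theorem abs_sub_le_radius (D : WindowData n m h i₀ p Q) {i : ℕ}
    (hi : i ∈ Finset.Ico i₀ (i₀ + (n - m))) : |p i - p h| ≤ radius n m h i₀ p := by
  obtain ⟨h1, h2⟩ := Finset.mem_Ico.1 hi
  have := D.start_le
  have := D.four_mul_le
  have h3 := D.le_of_le h1 (D.lt_of_mem_window hi)
  have h4 := D.le_of_le (show i ≤ i₀ + (n - m) - 1 by omega) (by omega)
  have h5 := le_max_left (p h - p i₀) (p (i₀ + (n - m) - 1) - p h)
  have h6 := le_max_right (p h - p i₀) (p (i₀ + (n - m) - 1) - p h)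
  unfold radius
  rw [abs_le]
  constructor <;> linarith

theorem exists_radius_le (D : WindowData n m h i₀ p Q) :
    ∃ q ∈ window n m i₀ p, radius n m h i₀ p ≤ |q - p h| := by
  have := D.start_le
  have := D.four_mul_le
  have := D.one_le
  rcases le_total (p h - p i₀) (p (i₀ + (n - m) - 1) - p h) with hle | hle
  · refine ⟨_, Finset.mem_image_of_mem p (Finset.mem_Ico.2 ⟨?_, ?_⟩ :
      i₀ + (n - m) - 1 ∈ Finset.Ico i₀ (i₀ + (n - m))), ?_⟩
    · omega
    · omega
    · rw [radius, max_eq_right hle]; exact le_abs_self _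
  · refine ⟨_, Finset.mem_image_of_mem p (Finset.mem_Ico.2 ⟨le_rfl, ?_⟩ :
      i₀ ∈ Finset.Ico i₀ (i₀ + (n - m))), ?_⟩
    · omega
    · rw [radius, max_eq_left hle, ← neg_sub]; exact neg_le_abs _

theorem radius_le_of_not_mem (D : WindowData n m h i₀ p Q) {q : ℝ} (hq : q ∈ points n p)
    (hqw : q ∉ window n m i₀ p) : radius n m h i₀ p ≤ |q - p h| := by
  obtain ⟨i, hi, rfl⟩ := Finset.mem_image.1 hq
  have hi := Finset.mem_range.1 hi
  rcases lt_or_ge i i₀ with h1 | h1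
  · refine (D.radius_le_left h1).trans ?_
    rw [← neg_sub]; exact neg_le_abs _
  · rcases lt_or_ge i (i₀ + (n - m)) with h2 | h2
    · exact absurd (Finset.mem_image_of_mem p (Finset.mem_Ico.2 ⟨h1, h2⟩)) hqw
    · exact (D.radius_le_right h2 hi).trans (le_abs_self _)

theorem abs_sub_le_of_mem_window (D : WindowData n m h i₀ p Q) {q : ℝ}
    (hq : q ∈ window n m i₀ p) : |q - p h| ≤ radius n m h i₀ p := by
  obtain ⟨i, hi, rfl⟩ := Finset.mem_image.1 hq
  exact D.abs_sub_le_radius hi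

theorem Q_eq_sum_window (D : WindowData n m h i₀ p Q) :
    Q = ∑ q ∈ window n m i₀ p, |q - p h| := by
  rw [window, Finset.sum_image (D.injOn fun i hi => D.lt_of_mem_window hi), D.Q_eq]

/-- At least a quarter of the points are inliers on the other side of the median. -/
theorem mul_abs_sub_le_robustCost (D : WindowData n m h i₀ p Q) (c : ℝ) :
    n / 4 * |c - p h| ≤ robustCost m (points n p) c := by
  have h1 := D.one_le
  have h2 := D.four_mul_le
  have h3 := D.two_mul_le
  have h4 := D.le_two_mul
  refine le_robustCost (by rw [D.card_points]; omega) fun L hL hLm => ?_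
  have key : ∀ s : Finset ℕ, (∀ i ∈ s, i < n) → n ≤ 4 * (s.card - m) →
      (∀ i ∈ s, |c - p h| ≤ |p i - c|) → n / 4 * |c - p h| ≤ ∑ q ∈ points n p \ L, dist q c := by
    intro s hs hcard hd
    have hsub : s.image p \ L ⊆ points n p \ L :=
      Finset.sdiff_subset_sdiff (Finset.image_subset_image fun i hi =>
        Finset.mem_range.2 (hs i hi)) le_rfl
    refine le_trans ?_ (Finset.sum_le_sum_of_subset_of_nonneg hsub fun q _ _ => dist_nonneg)
    refine le_trans ?_ (Finset.card_nsmul_le_sum _ _ |c - p h| fun q hq => ?_)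
    · rw [nsmul_eq_mul]
      refine mul_le_mul_of_nonneg_right ?_ (abs_nonneg _)
      have hc := Finset.le_card_sdiff L (s.image p)
      rw [D.card_image hs, hLm] at hc
      have : (n : ℝ) ≤ 4 * (s.image p \ L).card := by exact_mod_cast (by omega)
      linarith
    · obtain ⟨i, hi, rfl⟩ := Finset.mem_image.1 (Finset.mem_sdiff.1 hq).1
      exact hd i hi
  rcases le_total c (p h) with hc | hc
  · refine key (Finset.Ico h n) (fun i hi => (Finset.mem_Ico.1 hi).2)
      (by rw [Nat.card_Ico]; omega) fun i hi => ?_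
    have := D.le_of_le (Finset.mem_Ico.1 hi).1 (Finset.mem_Ico.1 hi).2
    rw [abs_of_nonpos (by linarith), abs_of_nonneg (by linarith)]
    linarith
  · refine key (Finset.range (h + 1)) (fun i hi => by have := Finset.mem_range.1 hi; omega)
      (by rw [Finset.card_range]; omega) fun i hi => ?_
    have := D.le_of_le (show i ≤ h by have := Finset.mem_range.1 hi; omega) (by omega)
    rw [abs_of_nonneg (by linarith), abs_of_nonpos (by linarith)]
    linarith

theorem Q_sub_le_robustCost (D : WindowData n m h i₀ p Q) (c : ℝ) :
    Q - n * |c - p h| ≤ robustCost m (points n p) c := by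
  have h2 := D.four_mul_le
  refine le_robustCost (by rw [D.card_points]; omega) fun L hL hLm => ?_
  have hcard : (points n p \ L).card = n - m := by
    rw [Finset.card_sdiff_of_subset hL, D.card_points, hLm]
  have h3 : Q ≤ ∑ q ∈ points n p \ L, |q - p h| := by
    rw [D.Q_eq_sum_window]
    refine sum_le_sum_of_nearest (P := points n p) (d := fun q => |q - p h|) Finset.sdiff_subset
      (by rw [hcard, D.card_window]) fun q hq r hr => ?_
    exact (D.abs_sub_le_of_mem_window hq).trans
      (D.radius_le_of_not_mem (Finset.mem_sdiff.1 hr).1 (Finset.mem_sdiff.1 hr).2)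
  have h4 : ∑ q ∈ points n p \ L, |q - p h| ≤ ∑ q ∈ points n p \ L, (dist q c + |c - p h|) :=
    Finset.sum_le_sum fun q _ => by
      rw [Real.dist_eq]; exact abs_sub_le _ _ _
  rw [Finset.sum_add_distrib, Finset.sum_const, hcard, nsmul_eq_mul] at h4
  have h5 : ((n - m : ℕ) : ℝ) * |c - p h| ≤ n * |c - p h| :=
    mul_le_mul_of_nonneg_right (by exact_mod_cast Nat.sub_le _ _) (abs_nonneg _)
  linarith

/-- The ball around `c` that contains the `n - m` nearest points has its endpoints outside the
middle part, and its radius differs from that of the window by at most the distance from `c` to the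
median. -/
theorem inlier_radius (D : WindowData n m h i₀ p Q) {c r : ℝ} {L : Finset ℝ}
    (hL : L ⊆ points n p) (hLm : L.card = m) (h1 : ∀ q ∈ points n p \ L, |q - c| ≤ r)
    (h2 : ∀ q ∈ L, r ≤ |q - c|) (h3 : ∃ q ∈ points n p \ L, |q - c| = r) :
    c - r ≤ p m ∧ p (n - m - 1) ≤ c + r ∧ |r - radius n m h i₀ p| ≤ |c - p h| := by
  have hm1 := D.one_le
  have hm4 := D.four_mul_le
  have hcard : (points n p \ L).card = n - m := by
    rw [Finset.card_sdiff_of_subset hL, D.card_points, hLm]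
  have far : ∀ s : Finset ℕ, (∀ i ∈ s, i < n) → m < s.card → ∃ i ∈ s, |p i - c| ≤ r := by
    intro s hs hsm
    by_contra! hcon
    have : s.image p ⊆ L := by
      intro q hq
      obtain ⟨i, hi, rfl⟩ := Finset.mem_image.1 hq
      by_contra hqL
      exact absurd (h1 _ (Finset.mem_sdiff.2 ⟨mem_points (hs i hi), hqL⟩)) (not_le.2 (hcon i hi))
    have := Finset.card_le_card this
    rw [D.card_image hs] at this
    omega
  refine ⟨?_, ?_, ?_⟩
  · obtain ⟨i, hi, hir⟩ := far (Finset.range (m + 1))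
      (fun i hi => by have := Finset.mem_range.1 hi; omega) (by rw [Finset.card_range]; omega)
    have := D.le_of_le (show i ≤ m by have := Finset.mem_range.1 hi; omega) (by omega)
    have := (abs_le.1 hir).1
    linarith
  · obtain ⟨i, hi, hir⟩ := far (Finset.Ico (n - m - 1) n)
      (fun i hi => (Finset.mem_Ico.1 hi).2) (by rw [Nat.card_Ico]; omega)
    have := D.le_of_le (Finset.mem_Ico.1 hi).1 (Finset.mem_Ico.1 hi).2
    have := (abs_le.1 hir).2
    linarith
  · rw [abs_le]
    constructor
    · by_contra! hlt
      -- otherwise every inlier is closer to the median than the radius of the window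
      have hin : ∀ q ∈ points n p \ L, |q - p h| < radius n m h i₀ p := fun q hq => by
        have := abs_sub_le q c (p h)
        have := h1 q hq
        linarith
      have hsub : points n p \ L ⊆ window n m i₀ p := fun q hq => by
        by_contra hqw
        exact absurd (hin q hq)
          (not_lt.2 (D.radius_le_of_not_mem (Finset.mem_sdiff.1 hq).1 hqw))
      have heq := Finset.eq_of_subset_of_card_le hsub (by rw [hcard, D.card_window])
      obtain ⟨q, hq, hqr⟩ := D.exists_radius_le
      rw [← heq] at hq
      exact absurd (hin q hq) (not_lt.2 hqr)
    · by_contra! hlt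
      obtain ⟨q, hq, hqr⟩ := h3
      have hin : ∀ q ∈ window n m i₀ p, |q - c| < r := fun q hq => by
        have := abs_sub_le q (p h) c
        have := D.abs_sub_le_of_mem_window hq
        rw [abs_sub_comm (p h) c] at *
        linarith
      have hsub : window n m i₀ p ⊆ points n p \ L := fun q hq =>
        Finset.mem_sdiff.2 ⟨D.window_subset hq, fun hqL => absurd (hin q hq) (not_lt.2 (h2 q hqL))⟩
      have heq := Finset.eq_of_subset_of_card_le hsub (by rw [hcard, D.card_window])
      rw [← heq] at hq
      exact absurd (hin q hq) (by rw [hqr]; exact lt_irrefl _)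

section Error

variable {δ : ℝ} {W : ℕ → ℝ}

/-- The error of the weights `W` in the sum of the distances to `y`. -/
noncomputable def indexError (n : ℕ) (p W : ℕ → ℝ) (y : ℝ) : ℝ :=
  ∑ i ∈ Finset.range n, (W i - 1) * |p i - y|

theorem indexError_nonneg (hB : Bucketed p (IsValid n m h i₀ p δ Q) n W) (y : ℝ) :
    0 ≤ indexError n p W y := by
  rcases hB.error y with h0 | ⟨s, e, -, -, -, -, -, h0, -⟩
  · exact h0.ge
  · exact h0

theorem le_of_not_violates_tail {s e : ℕ} (hv : ¬ Violates n m h p δ Q s e)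
    (ht : IsTail n m e) : (e : ℝ) - s ≤ δ * n := by
  by_contra! hlt
  exact hv (Or.inl ⟨ht, hlt⟩)

theorem le_of_not_violates_middle {s e : ℕ} (hv : ¬ Violates n m h p δ Q s e)
    (ht : ¬ IsTail n m e) :
    ((e : ℝ) - s) * (p e - p s) ≤ δ * (Q + n * |p e + p s - 2 * p h|) := by
  by_contra! hlt
  exact hv (Or.inr ⟨ht, hlt⟩)

theorem indexError_center_le (D : WindowData n m h i₀ p Q)
    (hB : Bucketed p (IsValid n m h i₀ p δ Q) n W) (hδ : 0 < δ) (c : ℝ) :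
    indexError n p W c ≤ 4 * δ * (Q + 2 * (n * |c - p h|)) := by
  have hn := D.n_pos
  have hQ := D.Q_pos
  have hm1 := D.one_le
  have hm4 := D.four_mul_le
  have hh1 := D.two_mul_le
  have hh2 := D.le_two_mul
  rcases hB.error c with h0 | ⟨s, e, hse, hen, ⟨hcut, hv⟩, hsc, hce, -, hle⟩
  · rw [indexError, h0]; positivity
  refine le_trans hle ?_
  have hse' : (1 : ℝ) ≤ (e : ℝ) - s := by
    have : (s : ℝ) + 1 ≤ e := by exact_mod_cast hse
    linarith
  -- a bucket with at least two points has at most twice as many points as gaps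
  have hcount : 2 * ((e : ℝ) + 1 - s) ≤ 4 * ((e : ℝ) - s) := by linarith
  have hmin0 : 0 ≤ min (c - p s) (p e - c) := le_min (by linarith) (by linarith)
  refine le_trans (mul_le_mul_of_nonneg_right hcount hmin0) ?_
  obtain ⟨c1, c2, c3, -⟩ := isValid_cut hcut
  have hside : min (c - p s) (p e - c) ≤ |c - p h| := by
    rcases c3 with c3 | c3
    · have := D.le_of_le c3.le (by omega)
      refine (min_le_right _ _).trans ((?_ : _ ≤ _).trans (neg_le_abs _))
      linarith
    · have := D.le_of_le c3 (by omega)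
      refine (min_le_left _ _).trans ((?_ : _ ≤ _).trans (le_abs_self _))
      linarith
  by_cases ht : IsTail n m e
  · have h1 := le_of_not_violates_tail hv ht
    have h2 : 4 * ((e : ℝ) - s) * min (c - p s) (p e - c) ≤ 4 * (δ * n) * |c - p h| := by
      gcongr
    have h3 : 0 ≤ δ * (n * |c - p h|) := by positivity
    nlinarith [mul_pos hδ hQ]
  · have h1 := le_of_not_violates_middle hv ht
    have hL : 0 < p e - p s := by linarith
    set g := min (c - p s) (p e - c) with hg
    have hgL : g ≤ p e - p s := (min_le_left _ _).trans (by linarith)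
    have hx : 0 ≤ |c - p h| := abs_nonneg _
    -- the sum of the two end distances is twice the near one plus the length
    have hkey : |p e + p s - 2 * p h| * g ≤ 2 * |c - p h| * (p e - p s) := by
      rcases c3 with c3 | c3
      · have h4 := D.le_of_le c3.le (by omega)
        have h5 : g ≤ p e - c := min_le_right _ _
        rw [abs_of_nonpos (by linarith), abs_of_nonpos (by linarith)]
        nlinarith [mul_nonneg (sub_nonneg.2 h4) (sub_nonneg.2 hgL)]
      · have h4 := D.le_of_le c3 (by omega)
        have h5 : g ≤ c - p s := min_le_left _ _
        rw [abs_of_nonneg (by linarith), abs_of_nonneg (by linarith)]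
        nlinarith [mul_nonneg (sub_nonneg.2 h4) (sub_nonneg.2 hgL)]
    have h6 : ((e : ℝ) - s) * g * (p e - p s) ≤
        δ * (Q + 2 * (n * |c - p h|)) * (p e - p s) := by
      calc ((e : ℝ) - s) * g * (p e - p s) = ((e : ℝ) - s) * (p e - p s) * g := by ring
        _ ≤ δ * (Q + n * |p e + p s - 2 * p h|) * g := mul_le_mul_of_nonneg_right h1 hmin0
        _ = δ * (Q * g + n * (|p e + p s - 2 * p h| * g)) := by ring
        _ ≤ δ * (Q * (p e - p s) + n * (2 * |c - p h| * (p e - p s))) := by gcongr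
        _ = _ := by ring
    have h7 := le_of_mul_le_mul_right h6 hL
    linarith

theorem indexError_kink_le (hB : Bucketed p (IsValid n m h i₀ p δ Q) n W)
    (D : WindowData n m h i₀ p Q) (hδ : 0 < δ) {y z d : ℝ} (hy : y ≤ p m ∨ p (n - m - 1) ≤ y)
    (hz : ∀ s e, s ≤ e → e < n → (∀ f ∈ cuts n m h i₀, ¬ (s < f ∧ f ≤ e)) → p e ≤ z ∨ z ≤ p s)
    (hd : |y - z| ≤ d) : indexError n p W y ≤ 4 * (δ * n) * d := by
  have hn := D.n_pos
  have hm1 := D.one_le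
  have hm4 := D.four_mul_le
  have hd0 : 0 ≤ d := (abs_nonneg _).trans hd
  rcases hB.error y with h0 | ⟨s, e, hse, hen, ⟨hcut, hv⟩, hsy, hye, -, hle⟩
  · rw [indexError, h0]; positivity
  refine le_trans hle ?_
  have hse' : (1 : ℝ) ≤ (e : ℝ) - s := by
    have : (s : ℝ) + 1 ≤ e := by exact_mod_cast hse
    linarith
  obtain ⟨c1, c2, -⟩ := isValid_cut hcut
  have ht : IsTail n m e := by
    by_contra ht
    unfold IsTail at ht
    have h1 := D.le_of_le (show m ≤ s by omega) (by omega)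
    have h2 := D.le_of_le (show e ≤ n - m - 1 by omega) (by omega)
    rcases hy with hy | hy <;> linarith
  have h1 := le_of_not_violates_tail hv ht
  have h2 : min (y - p s) (p e - y) ≤ d := by
    have h3 := abs_le.1 hd
    rcases hz s e hse.le hen hcut with h4 | h4
    · exact (min_le_right _ _).trans (by linarith)
    · exact (min_le_left _ _).trans (by linarith)
  have h0 : 0 ≤ min (y - p s) (p e - y) := le_min (by linarith) (by linarith)
  have h3 : 2 * ((e : ℝ) + 1 - s) ≤ 4 * (δ * n) := by linarith
  gcongr

theorem distError_eq (D : WindowData n m h i₀ p Q) {w : ℝ → ℝ} (hw : ∀ i < n, w (p i) = W i)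
    (y : ℝ) : distError (points n p) (((Finset.range n).filter fun i => W i ≠ 0).image p) w y =
      indexError n p W y := by
  unfold distError indexError points
  rw [Finset.sum_image (D.injOn fun i hi => Finset.mem_range.1 (Finset.mem_filter.1 hi).1),
    Finset.sum_image (D.injOn fun i hi => Finset.mem_range.1 hi), Finset.sum_filter,
    ← Finset.sum_sub_distrib]
  refine Finset.sum_congr rfl fun i hi => ?_
  rw [hw i (Finset.mem_range.1 hi)]
  split_ifs with h0
  · ring
  · rw [not_not.1 h0]; ring

/-- By duality, the error of the coreset at `c` is controlled by the errors in the sums of distances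
at `c` and at the endpoints of the ball that contains the inliers. -/
theorem isRobustCoreset {ε : ℝ} (D : WindowData n m h i₀ p Q) (hε : 0 < ε)
    (hB : Bucketed p (IsValid n m h i₀ p (ε / 64) Q) n W) {w : ℝ → ℝ}
    (hw : ∀ i < n, w (p i) = W i) :
    IsRobustCoreset m ε (points n p) (((Finset.range n).filter fun i => W i ≠ 0).image p) w := by
  have hδ : 0 < ε / 64 := by positivity
  have hn := D.n_pos
  have hm1 := D.one_le
  have hm4 := D.four_mul_le
  set S := ((Finset.range n).filter fun i => W i ≠ 0).image p with hS
  have herr : ∀ y, distError (points n p) S w y = indexError n p W y := D.distError_eq hw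
  have herr0 : ∀ y, 0 ≤ distError (points n p) S w y := fun y => by
    rw [herr]; exact indexError_nonneg hB y
  have hpos : ∀ q ∈ S, 0 < w q := fun q hq => by
    obtain ⟨i, hi, rfl⟩ := Finset.mem_image.1 hq
    obtain ⟨hi, h0⟩ := Finset.mem_filter.1 hi
    rw [hw i (Finset.mem_range.1 hi)]
    exact lt_of_le_of_ne (hB.nonneg i (Finset.mem_range.1 hi)) h0.symm
  have htot : ∑ q ∈ S, w q = (points n p).card := by
    rw [hS, Finset.sum_image (D.injOn fun i hi => Finset.mem_range.1 (Finset.mem_filter.1 hi).1),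
      D.card_points, ← hB.sum_eq, ← Finset.sum_filter_ne_zero (Finset.range n)]
    exact Finset.sum_congr rfl fun i hi => hw i (Finset.mem_range.1 (Finset.mem_filter.1 hi).1)
  have hx : ∀ c, ε * (n / 4 * |c - p h|) ≤ ε * robustCost m (points n p) c := fun c =>
    mul_le_mul_of_nonneg_left (D.mul_abs_sub_le_robustCost c) hε.le
  refine ⟨⟨hpos, htot, fun c => ?_, fun c => ?_⟩,
    Finset.image_subset_image (Finset.filter_subset _ _)⟩
  · obtain ⟨L, hL, hLm, hLd⟩ := exists_subset_forall_le (fun q => dist q c)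
      (P := points n p) (m := m) (by rw [D.card_points]; omega)
    have hne : (points n p \ L).Nonempty := by
      rw [← Finset.card_pos, Finset.card_sdiff_of_subset hL, D.card_points, hLm]; omega
    obtain ⟨q, hq, hmax⟩ := Finset.exists_max_image _ (fun q => dist q c) hne
    set r := dist q c with hr
    have h1 := robustCost_le_add_distError (m := m) (c := c) (r := r) hpos htot hL hLm dist_nonneg
      hmax (fun q' hq' => hLd q hq q' hq') (herr0 c)
    obtain ⟨k1, k2, k3⟩ := D.inlier_radius hL hLm hmax (fun q' hq' => hLd q hq q' hq')
      ⟨q, hq, rfl⟩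
    set R := radius n m h i₀ p with hR
    have hRl : p h - p i₀ ≤ R := le_max_left _ _
    have hRr : p (i₀ + (n - m) - 1) - p h ≤ R := le_max_right _ _
    have hi₀ := D.start_le
    obtain ⟨a1, a2⟩ := abs_le.1 k3
    have a3 := le_abs_self (c - p h)
    have a4 := neg_le_abs (c - p h)
    have e1 : indexError n p W (c - r) ≤ 4 * (ε / 64 * n) * (2 * |c - p h|) := by
      refine indexError_kink_le hB D hδ (z := p h - R) (Or.inl k1) ?_ ?_
      · intro s e hse hen hcut
        obtain ⟨-, -, -, c4, -⟩ := isValid_cut hcut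
        rcases c4 with c4 | c4
        · left
          have := D.radius_le_left c4
          linarith
        · right
          have := D.le_of_le c4 (by omega)
          linarith
      · rw [abs_le]
        constructor <;> linarith
    have e2 : indexError n p W (c + r) ≤ 4 * (ε / 64 * n) * (2 * |c - p h|) := by
      refine indexError_kink_le hB D hδ (z := p h + R) (Or.inr k2) ?_ ?_
      · intro s e hse hen hcut
        obtain ⟨-, -, -, -, c5⟩ := isValid_cut hcut
        rcases c5 with c5 | c5
        · left
          have := D.le_of_le (show e ≤ i₀ + (n - m) - 1 by omega) (by omega)
          linarith
        · right
          have := D.radius_le_right c5 (by omega)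
          linarith
      · rw [abs_le]
        constructor <;> linarith
    rw [herr, herr] at h1
    have h2 := hx c
    have h3 : 0 ≤ ε * (n * |c - p h|) := by positivity
    linarith
  · have h1 := weightedRobustCost_le_add_distError (m := m) (c := c) hpos
      (by rw [D.card_points]; omega) htot herr0
    rw [herr] at h1
    have h2 := D.indexError_center_le hB hδ c
    have h3 := mul_le_mul_of_nonneg_left (D.Q_sub_le_robustCost c) hε.le
    have h4 := hx c
    have h5 : 0 ≤ ε * (n * |c - p h|) := by positivity
    have h6 : 0 ≤ ε * robustCost m (points n p) c := le_trans (by positivity) h4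
    linarith

end Error

end WindowData

/-! ### Scanning the points: one step of the bucketing -/

namespace WindowData

variable {n m h i₀ : ℕ} {p : ℕ → ℝ} {Q δ : ℝ} {W : ℕ → ℝ} {s j : ℕ}

/-- The number of nonzero weights on the indices below `N`. -/
noncomputable def nonzeroCount (W : ℕ → ℝ) (N : ℕ) : ℕ :=
  ((Finset.range N).filter fun i => W i ≠ 0).card

theorem nonzeroCount_congr {W' : ℕ → ℝ} {N : ℕ} (hW : ∀ i < N, W' i = W i) :
    nonzeroCount W' N = nonzeroCount W N := by
  unfold nonzeroCount
  congr 1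
  exact Finset.filter_congr fun i hi => by rw [hW i (Finset.mem_range.1 hi)]

theorem nonzeroCount_le_add_two
    (hW : ∀ i, s ≤ i → i ≤ j → W i = bucketWeight p s j i) :
    nonzeroCount W (j + 1) ≤ nonzeroCount W s + 2 := by
  unfold nonzeroCount
  have hsub : ((Finset.range (j + 1)).filter fun i => W i ≠ 0) ⊆
      ((Finset.range s).filter fun i => W i ≠ 0) ∪ {s, j} := by
    intro i hi
    obtain ⟨hi, h0⟩ := Finset.mem_filter.1 hi
    have hi := Finset.mem_range.1 hi
    simp only [Finset.mem_union, Finset.mem_filter, Finset.mem_range, Finset.mem_insert,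
      Finset.mem_singleton]
    by_contra! hcon
    have his : s ≤ i := by
      by_contra hlt
      exact h0 (hcon.1 (by omega))
    refine h0 ?_
    rw [hW i his (by omega), bucketWeight, if_neg hcon.2.1, if_neg hcon.2.2]
  refine (Finset.card_le_card hsub).trans ((Finset.card_union_le _ _).trans ?_)
  exact Nat.add_le_add_left Finset.card_le_two _

/-- The state of the scan once the indices up to `j` have been processed, the current bucket having
started at `s`: the weights of the closed buckets are final, those of the current bucket are what
they would be if it were closed now, and the number of nonzero weights of the closed buckets is paid
for by the potential and the cuts. -/
structure ScanState (n m h i₀ : ℕ) (p : ℕ → ℝ) (δ Q : ℝ) (s j : ℕ) (W : ℕ → ℝ) : Prop where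
  start_le : s ≤ j
  lt : j < n
  valid : IsValid n m h i₀ p δ Q s j
  closed : Bucketed p (IsValid n m h i₀ p δ Q) s W
  current : ∀ i, s ≤ i → i ≤ j → W i = bucketWeight p s j i
  count : (nonzeroCount W s : ℝ) ≤ 2 * (potential n m h p δ Q s - potential n m h p δ Q 0 +
    ((cuts n m h i₀).filter (· ≤ s)).card)

theorem isValid_self (D : WindowData n m h i₀ p Q) (hδ : 0 < δ) (s : ℕ) :
    IsValid n m h i₀ p δ Q s s := by
  have := D.n_pos
  have := D.Q_pos
  refine ⟨fun f _ => by omega, ?_⟩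
  rintro (⟨-, h1⟩ | ⟨-, h1⟩)
  · have : 0 < δ * n := by positivity
    linarith
  · have : 0 ≤ δ * (Q + n * |p s + p s - 2 * p h|) := by positivity
    rw [sub_self, zero_mul] at h1
    linarith

theorem bucketWeight_self (p : ℕ → ℝ) (s : ℕ) : bucketWeight p s s s = 1 := by
  simp [bucketWeight]

theorem ScanState.init (D : WindowData n m h i₀ p Q) (hδ : 0 < δ) (hW : W 0 = 1) :
    ScanState n m h i₀ p δ Q 0 0 W where
  start_le := le_rfl
  lt := by
    have := D.one_le
    have := D.four_mul_le
    omega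
  valid := D.isValid_self hδ 0
  closed := Bucketed.zero p _ W
  current i _ hi := by rw [Nat.le_zero.1 hi, hW, bucketWeight_self]
  count := by
    rw [sub_self, zero_add, nonzeroCount, Finset.range_zero, Finset.filter_empty,
      Finset.card_empty, Nat.cast_zero]
    positivity

theorem ScanState.closed_succ (D : WindowData n m h i₀ p Q)
    (S : ScanState n m h i₀ p δ Q s j W) :
    Bucketed p (IsValid n m h i₀ p δ Q) (j + 1) W :=
  S.closed.append D.mono S.start_le S.lt (fun _ => S.valid) S.current

/-- The current bucket is closed and the index `j + 1` starts a new one. -/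
theorem ScanState.break (D : WindowData n m h i₀ p Q) (hδ : 0 < δ)
    (S : ScanState n m h i₀ p δ Q s j W) (hj : j + 1 < n)
    (hb : j + 1 ∈ cuts n m h i₀ ∨ Violates n m h p δ Q s (j + 1)) {W' : ℕ → ℝ}
    (hW' : ∀ i ≤ j, W' i = W i) (h1 : W' (j + 1) = 1) :
    ScanState n m h i₀ p δ Q (j + 1) (j + 1) W' where
  start_le := le_rfl
  lt := hj
  valid := D.isValid_self hδ _
  closed := (S.closed_succ D).congr fun i hi => hW' i (by omega)
  current i h2 h3 := by rw [le_antisymm h3 h2, h1, bucketWeight_self]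
  count := by
    have hsj := S.start_le
    have hc : (nonzeroCount W' (j + 1) : ℝ) ≤ nonzeroCount W s + 2 := by
      rw [nonzeroCount_congr fun i hi => hW' i (by omega)]
      exact_mod_cast nonzeroCount_le_add_two S.current
    have hcount := S.count
    have hmono := D.potential_mono hδ (show s ≤ j + 1 by omega) hj
    by_cases hcut : j + 1 ∈ cuts n m h i₀
    · have : ((cuts n m h i₀).filter (· ≤ s)).card + 1 ≤
          ((cuts n m h i₀).filter (· ≤ j + 1)).card := by
        refine Finset.card_lt_card (Finset.ssubset_iff_subset_ne.2 ⟨fun f hf => ?_, fun he => ?_⟩)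
        · obtain ⟨f1, f2⟩ := Finset.mem_filter.1 hf
          exact Finset.mem_filter.2 ⟨f1, by omega⟩
        · have hmem : j + 1 ∈ (cuts n m h i₀).filter (· ≤ j + 1) :=
            Finset.mem_filter.2 ⟨hcut, le_rfl⟩
          rw [← he] at hmem
          have := (Finset.mem_filter.1 hmem).2
          omega
      have : (((cuts n m h i₀).filter (· ≤ s)).card : ℝ) + 1 ≤
          ((cuts n m h i₀).filter (· ≤ j + 1)).card := by exact_mod_cast this
      linarith
    · have hstep := D.potential_step hδ (show s < j + 1 by omega) hj (fun f hf hsf => by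
        have := S.valid.1 f hf
        have : f = j + 1 := by omega
        exact hcut (this ▸ hf)) (hb.resolve_left hcut)
      have : ((cuts n m h i₀).filter (· ≤ s)).card ≤ ((cuts n m h i₀).filter (· ≤ j + 1)).card :=
        Finset.card_le_card fun f hf => by
          obtain ⟨f1, f2⟩ := Finset.mem_filter.1 hf
          exact Finset.mem_filter.2 ⟨f1, by omega⟩
      have : (((cuts n m h i₀).filter (· ≤ s)).card : ℝ) ≤
          ((cuts n m h i₀).filter (· ≤ j + 1)).card := by exact_mod_cast this
      linarith

/-- The index `j + 1` joins the current bucket. -/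
theorem ScanState.extend (S : ScanState n m h i₀ p δ Q s j W) (hj : j + 1 < n)
    (hcut : j + 1 ∉ cuts n m h i₀) (hv : ¬ Violates n m h p δ Q s (j + 1)) {W' : ℕ → ℝ}
    (hW' : ∀ i < s, W' i = W i)
    (hcur : ∀ i, s ≤ i → i ≤ j + 1 → W' i = bucketWeight p s (j + 1) i) :
    ScanState n m h i₀ p δ Q s (j + 1) W' where
  start_le := by have := S.start_le; omega
  lt := hj
  valid := ⟨fun f hf hsf => by
    have := S.valid.1 f hf
    have : f = j + 1 := by omega
    exact hcut (this ▸ hf), hv⟩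
  closed := S.closed.congr hW'
  current := hcur
  count := by rw [nonzeroCount_congr hW']; exact S.count

theorem ScanState.count_le (D : WindowData n m h i₀ p Q) (hδ : 0 < δ)
    (S : ScanState n m h i₀ p δ Q s j W) :
    (nonzeroCount W (j + 1) : ℝ) ≤ 2 * (2 * m / (δ * n) + 2 / √δ + 6) := by
  have h1 : (nonzeroCount W (j + 1) : ℝ) ≤ nonzeroCount W s + 2 := by
    exact_mod_cast nonzeroCount_le_add_two S.current
  have h2 := S.count
  have h3 := D.potential_sub_le hδ (S.start_le.trans_lt S.lt)
  have h4 : (((cuts n m h i₀).filter (· ≤ s)).card : ℝ) ≤ 5 := by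
    exact_mod_cast (Finset.card_filter_le _ _).trans Finset.card_le_five
  linarith

end WindowData

/-! ### Verification rules for the real RAM -/

namespace RealRAM

/-- The program has no loops. -/
def Program.Straight : Program → Prop
  | .seq p q => p.Straight ∧ q.Straight
  | .ite _ p q => p.Straight ∧ q.Straight
  | .loop _ _ => False
  | _ => True

open Classical in
/-- The final memory of a program without loops. -/
noncomputable def Program.exec : Program → Memory → Memory
  | .skip, σ => σ
  | .setNat x e, σ => { σ with nat := Function.update σ.nat x (e.eval σ) }
  | .setReal x e, σ => { σ with real := Function.update σ.real x (e.eval σ) }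
  | .store a i e, σ =>
    { σ with arr := Function.update σ.arr a (Function.update (σ.arr a) (i.eval σ) (e.eval σ)) }
  | .seq p q, σ => q.exec (p.exec σ)
  | .ite b p q, σ => if b.holds σ then p.exec σ else q.exec σ
  | .loop _ _, σ => σ

/-- An upper bound for the number of steps of a program when every loop is entered only once. -/
def Program.maxSteps : Program → ℕ
  | .skip => 1
  | .setNat _ e => e.steps + 1
  | .setReal _ e => e.steps + 1
  | .store _ i e => i.steps + e.steps + 1
  | .seq p q => p.maxSteps + q.maxSteps
  | .ite b p q => b.steps + 1 + (p.maxSteps + q.maxSteps)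
  | .loop b p => b.steps + 1 + p.maxSteps

theorem exists_run_exec {p : Program} (hp : p.Straight) (σ : Memory) :
    ∃ t ≤ p.maxSteps, Run p σ (p.exec σ) t := by
  induction p generalizing σ with
  | skip => exact ⟨_, le_rfl, Run.skip σ⟩
  | setNat x e => exact ⟨_, le_rfl, Run.setNat x e σ⟩
  | setReal x e => exact ⟨_, le_rfl, Run.setReal x e σ⟩
  | store a i e => exact ⟨_, le_rfl, Run.store a i e σ⟩
  | seq p q ihp ihq =>
    obtain ⟨t, ht, hr⟩ := ihp hp.1 σ
    obtain ⟨t', ht', hr'⟩ := ihq hp.2 (p.exec σ)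
    exact ⟨_, Nat.add_le_add ht ht', Run.seq hr hr'⟩
  | ite b p q ihp ihq =>
    by_cases hb : b.holds σ
    · obtain ⟨t, ht, hr⟩ := ihp hp.1 σ
      refine ⟨b.steps + 1 + t, by simp only [Program.maxSteps]; omega, ?_⟩
      rw [Program.exec, if_pos hb]
      exact Run.iteTrue q hb hr
    · obtain ⟨t, ht, hr⟩ := ihq hp.2 σ
      refine ⟨b.steps + 1 + t, by simp only [Program.maxSteps]; omega, ?_⟩
      rw [Program.exec, if_neg hb]
      exact Run.iteFalse p hb hr
  | loop b p _ => exact hp.elim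

/-- Started with the memory `σ`, the program halts with a memory satisfying `R`, within a number of
steps that accounts for `N` rounds of every loop and the final evaluation of its test. -/
def Computes (p : Program) (σ : Memory) (N : ℕ) (R : Memory → Prop) : Prop :=
  ∃ τ t, Run p σ τ t ∧ t ≤ p.maxSteps * (N + 1) ∧ R τ

namespace Computes

variable {p q : Program} {σ : Memory} {N : ℕ} {R R' : Memory → Prop}

theorem of_straight (hp : p.Straight) (hR : R (p.exec σ)) : Computes p σ N R := by
  obtain ⟨t, ht, hr⟩ := exists_run_exec hp σ
  exact ⟨_, t, hr, ht.trans (Nat.le_mul_of_pos_right _ N.succ_pos), hR⟩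

theorem seq (hp : Computes p σ N R) (hq : ∀ τ, R τ → Computes q τ N R') :
    Computes (.seq p q) σ N R' := by
  obtain ⟨τ, t, hr, ht, hR⟩ := hp
  obtain ⟨ρ, t', hr', ht', hR'⟩ := hq τ hR
  exact ⟨ρ, t + t', Run.seq hr hr', (Nat.add_le_add ht ht').trans_eq (add_mul _ _ _).symm, hR'⟩

/-- A loop with invariant `I` and variant `v`. -/
theorem loop {b : Test} (hp : p.Straight) {I : Memory → Prop} {v : Memory → ℕ}
    (hstep : ∀ σ, I σ → b.holds σ → I (p.exec σ) ∧ v (p.exec σ) < v σ) (hσ : I σ) (hN : v σ ≤ N) :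
    Computes (.loop b p) σ N fun τ => I τ ∧ ¬ b.holds τ := by
  induction N generalizing σ with
  | zero =>
    have hb : ¬ b.holds σ := fun hb => by
      have := (hstep σ hσ hb).2
      omega
    exact ⟨σ, _, Run.loopStop p hb, by simp only [Program.maxSteps]; omega, hσ, hb⟩
  | succ N ih =>
    by_cases hb : b.holds σ
    · obtain ⟨h1, h2⟩ := hstep σ hσ hb
      obtain ⟨t, ht, hr⟩ := exists_run_exec hp σ
      obtain ⟨τ, t', hr', ht', hR⟩ := ih h1 (by omega)
      refine ⟨τ, _, Run.loopStep hb hr hr', ?_, hR⟩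
      rw [mul_add _ (N + 1), mul_one]
      simp only [Program.maxSteps] at *
      omega
    · refine ⟨σ, _, Run.loopStop p hb, ?_, hσ, hb⟩
      rw [mul_add _ (N + 1), mul_one]
      simp only [Program.maxSteps]
      omega

theorem mono (h : Computes p σ N R) (hR : ∀ τ, R τ → R' τ) : Computes p σ N R' := by
  obtain ⟨τ, t, hr, ht, h1⟩ := h
  exact ⟨τ, t, hr, ht, hR τ h1⟩

end Computes

/-! ### The linear-time program -/

namespace Test

/-- Disjunction of tests. -/
def disj (a b : Test) : Test := neg (conj (neg a) (neg b))

/-- Equality of integers. -/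
def natEq (a b : NatExp) : Test := conj (neg (natLt a b)) (neg (natLt b a))

theorem holds_disj {a b : Test} {σ : Memory} : (disj a b).holds σ ↔ a.holds σ ∨ b.holds σ := by
  simp only [disj, holds]
  tauto

theorem holds_natEq {a b : NatExp} {σ : Memory} : (natEq a b).holds σ ↔ a.eval σ = b.eval σ := by
  simp only [natEq, holds]
  omega

end Test

namespace CoresetProgram

/-- `n - m`. -/
def windowSize : NatExp := .sub (.var 0) (.var 1)

/-- The median of the dataset; integer register `2` holds its index. -/
def median : RealExp := .get 0 (.var 2)

/-- Compute the index of the median in integer register `2`. -/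
def findMedian : Program :=
  .loop (.natLt (.add (.add (.var 2) (.var 2)) (.const 1)) (.var 0))
    (.setNat 2 (.add (.var 2) (.const 1)))

/-- Compute in integer register `3` the start of the window nearest to the median. -/
def findWindow : Program :=
  .loop (.conj (.natLt (.var 3) (.var 1))
      (.realLt (.sub (.get 0 (.add (.var 3) windowSize)) median) (.sub median (.get 0 (.var 3)))))
    (.setNat 3 (.add (.var 3) (.const 1)))

/-- The round of `sumWindow`. -/
def sumRound : Program :=
  .seq
    (.ite (.natLt (.var 4) (.var 2))
      (.setReal 1 (.add (.var 1) (.sub median (.get 0 (.var 4)))))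
      (.setReal 1 (.add (.var 1) (.sub (.get 0 (.var 4)) median))))
    (.setNat 4 (.add (.var 4) (.const 1)))

/-- Compute in real register `1` the sum of the distances of the window to the median. -/
def sumWindow : Program :=
  .seq (.setNat 4 (.var 3)) (.loop (.natLt (.var 4) (.add (.var 3) windowSize)) sumRound)

/-- The index in integer register `4` is in the first or last `m` ones. -/
def tailTest : Test := .disj (.natLt (.var 4) (.var 1)) (.neg (.natLt (.var 4) windowSize))

/-- `ε / 64`. -/
def accuracy : RealExp := .div (.var 0) (.const 64)

/-- The difference of the indices in integer registers `4` and `5`. -/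
def gaps : RealExp := .sub (.ofNat (.var 4)) (.ofNat (.var 5))

/-- The length of the interval from the start of the current bucket to the current point. -/
def length : RealExp := .sub (.get 0 (.var 4)) (.get 0 (.var 5))

/-- `n` times the signed sum of the distances of the two ends of the bucket to the median. -/
def offset : RealExp :=
  .mul (.ofNat (.var 0))
    (.sub (.add (.get 0 (.var 4)) (.get 0 (.var 5))) (.mul (.const 2) median))

/-- The test of the bucketing rule. The absolute value is split into two comparisons. -/
def violatesTest : Test :=
  .disj (.conj tailTest (.realLt (.mul accuracy (.ofNat (.var 0))) gaps))
    (.conj (.neg tailTest)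
      (.conj (.realLt (.mul accuracy (.add (.var 1) offset)) (.mul gaps length))
        (.realLt (.mul accuracy (.sub (.var 1) offset)) (.mul gaps length))))

/-- Whether the current point starts a new bucket. -/
def breakTest : Test :=
  .disj (.natEq (.var 4) (.var 1)) <| .disj (.natEq (.var 4) windowSize) <|
  .disj (.natEq (.var 4) (.var 2)) <| .disj (.natEq (.var 4) (.var 3)) <|
  .disj (.natEq (.var 4) (.add (.var 3) windowSize)) violatesTest

/-- Start a new bucket. -/
def openBucket : Program :=
  .seq (.store 2 (.var 4) (.const 1)) (.seq (.setNat 5 (.var 4)) (.setReal 2 (.const 0)))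

/-- Let the current point join the current bucket; real register `2` holds the sum of the distances
of the points of the bucket to its first point. -/
def extendBucket : Program :=
  .seq (.setReal 2 (.add (.var 2) length)) <|
  .seq (.store 2 (.sub (.var 4) (.const 1)) (.const 0)) <|
  .seq (.store 2 (.var 5)
    (.sub (.ofNat (.add (.sub (.var 4) (.var 5)) (.const 1))) (.div (.var 2) length)))
    (.store 2 (.var 4) (.div (.var 2) length))

/-- The round of `scan`. -/
def scanRound : Program :=
  .seq (.setNat 4 (.add (.var 4) (.const 1))) (.ite breakTest openBucket extendBucket)

/-- Preparation of `scan`. -/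
def scanInit : Program :=
  .seq (.setNat 4 (.const 0)) <| .seq (.setNat 5 (.const 0)) <|
  .seq (.setReal 2 (.const 0)) (.store 2 (.const 0) (.const 1))

/-- Compute the weights of all points, most of which are zero, in array `2`. -/
def scan : Program :=
  .seq scanInit (.loop (.natLt (.add (.var 4) (.const 1)) (.var 0)) scanRound)

/-- The round of `compact`. -/
def compactRound : Program :=
  .seq
    (.ite (.realLt (.const 0) (.get 2 (.var 4)))
      (.seq (.store 0 (.var 6) (.get 0 (.var 4)))
        (.seq (.store 1 (.var 6) (.get 2 (.var 4))) (.setNat 6 (.add (.var 6) (.const 1)))))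
      .skip)
    (.setNat 4 (.add (.var 4) (.const 1)))

/-- Move the points of positive weight to the front of array `0` and their weights to array `1`. -/
def compact : Program :=
  .seq (.seq (.setNat 4 (.const 0)) (.setNat 6 (.const 0)))
    (.seq (.loop (.natLt (.var 4) (.var 0)) compactRound) (.setNat 0 (.var 6)))

/-- The program computing the coreset. -/
def coreset : Program :=
  .seq findMedian (.seq findWindow (.seq sumWindow (.seq scan compact)))

/-- The registers that stay fixed once computed: `h` is the index of the median, `i₀` the start of
the window and `Q` the sum of its distances to the median. -/
structure Frame (n m : ℕ) (p : ℕ → ℝ) (ε : ℝ) (h i₀ : ℕ) (Q : ℝ) (σ : Memory) : Prop where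
  nat_zero : σ.nat 0 = n
  nat_one : σ.nat 1 = m
  nat_two : σ.nat 2 = h
  nat_three : σ.nat 3 = i₀
  real_zero : σ.real 0 = ε
  real_one : σ.real 1 = Q
  arr_zero : σ.arr 0 = p

variable {n m h i₀ : ℕ} {p : ℕ → ℝ} {ε Q : ℝ} {σ : Memory}

theorem findMedian_computes (F : Frame n m p ε 0 0 0 σ) :
    Computes findMedian σ n
      fun τ => ∃ h, 2 * h ≤ n ∧ n ≤ 2 * h + 1 ∧ Frame n m p ε h 0 0 τ := by
  refine (Computes.loop (I := fun τ => ∃ h, 2 * h ≤ n ∧ Frame n m p ε h 0 0 τ)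
    (v := fun τ => n - τ.nat 2) (by trivial) ?_ ⟨0, by omega, F⟩ (Nat.sub_le _ _)).mono ?_
  · rintro τ ⟨h, hh, F⟩ hb
    simp only [Test.holds, NatExp.eval, F.nat_zero, F.nat_two] at hb
    refine ⟨⟨h + 1, by omega, ?_⟩, ?_⟩
    · constructor <;> simp [Program.exec, NatExp.eval, F.nat_zero, F.nat_one, F.nat_two,
        F.nat_three, F.real_zero, F.real_one, F.arr_zero]
    · simp only [Program.exec, NatExp.eval, F.nat_two, Function.update_self]
      omega
  · rintro τ ⟨⟨h, hh, F⟩, hb⟩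
    simp only [Test.holds, NatExp.eval, F.nat_zero, F.nat_two] at hb
    exact ⟨h, hh, by omega, F⟩

theorem findWindow_computes (hm : m ≤ n) (F : Frame n m p ε h 0 0 σ) :
    Computes findWindow σ n
      fun τ => ∃ i₀, i₀ ≤ m ∧ (∀ i < i₀, p (i + (n - m)) - p h < p h - p i) ∧
        (i₀ < m → p h - p i₀ ≤ p (i₀ + (n - m)) - p h) ∧ Frame n m p ε h i₀ 0 τ := by
  refine (Computes.loop (I := fun τ => ∃ i₀, i₀ ≤ m ∧
    (∀ i < i₀, p (i + (n - m)) - p h < p h - p i) ∧ Frame n m p ε h i₀ 0 τ)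
    (v := fun τ => m - τ.nat 3) (by trivial) ?_ ⟨0, by omega, by simp, F⟩
    ((Nat.sub_le _ _).trans hm)).mono
    ?_
  · rintro τ ⟨i₀, hi₀, hl, F⟩ hb
    simp only [Test.holds, NatExp.eval, RealExp.eval, windowSize, median, F.nat_zero, F.nat_one,
      F.nat_two, F.nat_three, F.arr_zero] at hb
    refine ⟨⟨i₀ + 1, by omega, fun i hi => ?_, ?_⟩, ?_⟩
    · rcases Nat.lt_succ_iff_lt_or_eq.1 hi with hi | rfl
      · exact hl i hi
      · exact hb.2
    · constructor <;> simp [Program.exec, NatExp.eval, F.nat_zero, F.nat_one, F.nat_two,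
        F.nat_three, F.real_zero, F.real_one, F.arr_zero]
    · simp only [Program.exec, NatExp.eval, F.nat_three, Function.update_self]
      omega
  · rintro τ ⟨⟨i₀, hi₀, hl, F⟩, hb⟩
    simp only [Test.holds, NatExp.eval, RealExp.eval, windowSize, median, F.nat_zero, F.nat_one,
      F.nat_two, F.nat_three, F.arr_zero, not_and, not_lt] at hb
    exact ⟨i₀, hi₀, hl, hb, F⟩

theorem sumWindow_computes (hp : StrictMonoOn p (Set.Iio n)) (hm : m ≤ n) (hi₀ : i₀ ≤ m)
    (hh : h < n) (F : Frame n m p ε h i₀ 0 σ) :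
    Computes sumWindow σ n
      (Frame n m p ε h i₀ (∑ i ∈ Finset.Ico i₀ (i₀ + (n - m)), |p i - p h|)) := by
  refine (Computes.of_straight (p := .setNat 4 (.var 3)) (R := fun τ => τ.nat 4 = i₀ ∧
    Frame n m p ε h i₀ 0 τ) trivial ⟨?_, ?_⟩).seq ?_
  · simp [Program.exec, NatExp.eval, F.nat_three]
  · constructor <;> simp [Program.exec, NatExp.eval, F.nat_zero, F.nat_one, F.nat_two,
      F.nat_three, F.real_zero, F.real_one, F.arr_zero]
  rintro τ ⟨h4, F⟩
  refine (Computes.loop (I := fun τ => i₀ ≤ τ.nat 4 ∧ τ.nat 4 ≤ i₀ + (n - m) ∧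
    Frame n m p ε h i₀ (∑ i ∈ Finset.Ico i₀ (τ.nat 4), |p i - p h|) τ)
    (v := fun τ => i₀ + (n - m) - τ.nat 4) (by simp [sumRound, Program.Straight]) ?_
    ⟨by omega, by omega, by simpa [h4] using F⟩ (by omega)).mono ?_
  · rintro τ ⟨h1, h2, F⟩ hb
    simp only [Test.holds, NatExp.eval, windowSize, F.nat_zero, F.nat_one, F.nat_three] at hb
    have hnat : (sumRound.exec τ).nat = Function.update τ.nat 4 (τ.nat 4 + 1) := by
      by_cases hlt : τ.nat 4 < τ.nat 2 <;>
        simp [sumRound, Program.exec, NatExp.eval, Test.holds, hlt]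
    have hreal : (sumRound.exec τ).real = Function.update τ.real 1
        (∑ i ∈ Finset.Ico i₀ (τ.nat 4 + 1), |p i - p h|) := by
      rw [Finset.sum_Ico_succ_top h1]
      by_cases hlt : τ.nat 4 < τ.nat 2
      · have : p (τ.nat 4) < p h := hp (Set.mem_Iio.2 (by omega)) (Set.mem_Iio.2 hh)
          (by rw [← F.nat_two]; exact hlt)
        simp [sumRound, Program.exec, NatExp.eval, RealExp.eval, Test.holds, median,
          F.nat_two ▸ hlt, F.real_one, F.arr_zero, F.nat_two, abs_of_neg (sub_neg.2 this)]
      · have : p h ≤ p (τ.nat 4) := hp.monotoneOn (Set.mem_Iio.2 hh) (Set.mem_Iio.2 (by omega))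
          (by rw [← F.nat_two]; omega)
        simp [sumRound, Program.exec, NatExp.eval, RealExp.eval, Test.holds, median,
          F.nat_two ▸ hlt, F.real_one, F.arr_zero, F.nat_two, abs_of_nonneg (sub_nonneg.2 this)]
    have harr : (sumRound.exec τ).arr = τ.arr := by
      by_cases hlt : τ.nat 4 < τ.nat 2 <;>
        simp [sumRound, Program.exec, Test.holds, NatExp.eval, hlt]
    have h4 : (sumRound.exec τ).nat 4 = τ.nat 4 + 1 := by rw [hnat, Function.update_self]
    refine ⟨⟨by omega, by omega, ?_⟩, by omega⟩
    rw [h4]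
    constructor <;> simp [hnat, hreal, harr, F.nat_zero, F.nat_one, F.nat_two,
        F.nat_three, F.real_zero, F.arr_zero]
  · rintro τ ⟨⟨h1, h2, F⟩, hb⟩
    simp only [Test.holds, NatExp.eval, windowSize, F.nat_zero, F.nat_one, F.nat_three] at hb
    have : τ.nat 4 = i₀ + (n - m) := by omega
    rwa [this] at F

end CoresetProgram

end RealRAM

/-! ### Correctness of the program -/

namespace RealRAM

namespace CoresetProgram

open WindowData

variable {n m h i₀ : ℕ} {p : ℕ → ℝ} {ε Q : ℝ} {σ : Memory}

theorem tailTest_holds (F : Frame n m p ε h i₀ Q σ) :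
    tailTest.holds σ ↔ IsTail n m (σ.nat 4) := by
  simp only [tailTest, Test.holds_disj, Test.holds, NatExp.eval, windowSize, F.nat_zero, F.nat_one,
    IsTail, not_lt]

theorem mul_add_mul_abs_lt_iff {δ Q R a : ℝ} (n : ℕ) (hδ : 0 ≤ δ) :
    δ * (Q + n * |a|) < R ↔ δ * (Q + n * a) < R ∧ δ * (Q - n * a) < R := by
  have hn : (0 : ℝ) ≤ n := n.cast_nonneg
  rcases abs_cases a with ⟨h1, h2⟩ | ⟨h1, h2⟩
  · rw [h1]
    refine ⟨fun h => ⟨h, lt_of_le_of_lt ?_ h⟩, fun h => h.1⟩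
    exact mul_le_mul_of_nonneg_left (by nlinarith) hδ
  · rw [h1, mul_neg, ← sub_eq_add_neg]
    refine ⟨fun h => ⟨lt_of_le_of_lt ?_ h, h⟩, fun h => h.2⟩
    exact mul_le_mul_of_nonneg_left (by nlinarith) hδ

theorem violatesTest_holds (hε : 0 < ε) (F : Frame n m p ε h i₀ Q σ) :
    violatesTest.holds σ ↔ Violates n m h p (ε / 64) Q (σ.nat 5) (σ.nat 4) := by
  have h64 : (((64 : ℚ)) : ℝ) = 64 := by norm_num
  have h2 : (((2 : ℚ)) : ℝ) = 2 := by norm_num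
  simp only [violatesTest, Test.holds_disj, Test.holds, tailTest_holds F, Violates,
    mul_add_mul_abs_lt_iff n (show 0 ≤ ε / 64 by positivity), RealExp.eval, NatExp.eval, accuracy,
    gaps, length, offset, median, F.nat_zero, F.nat_two, F.real_zero, F.real_one, F.arr_zero, h64,
    h2]

theorem breakTest_holds (hε : 0 < ε) (F : Frame n m p ε h i₀ Q σ) :
    breakTest.holds σ ↔ σ.nat 4 ∈ cuts n m h i₀ ∨
      Violates n m h p (ε / 64) Q (σ.nat 5) (σ.nat 4) := by
  simp only [breakTest, Test.holds_disj, Test.holds_natEq, violatesTest_holds hε F, NatExp.eval,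
    windowSize, F.nat_zero, F.nat_one, F.nat_two, F.nat_three, cuts, Finset.mem_insert,
    Finset.mem_singleton]
  tauto

/-- The invariant of `scan`. -/
structure ScanInv (n m : ℕ) (p : ℕ → ℝ) (ε : ℝ) (h i₀ : ℕ) (Q : ℝ) (σ : Memory) : Prop where
  frame : Frame n m p ε h i₀ Q σ
  state : ScanState n m h i₀ p (ε / 64) Q (σ.nat 5) (σ.nat 4) (σ.arr 2)
  sum_eq : σ.real 2 = bucketSum p (σ.nat 5) (σ.nat 4)

theorem bucketSum_succ {s j : ℕ} (hsj : s ≤ j + 1) :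
    bucketSum p s (j + 1) = bucketSum p s j + (p (j + 1) - p s) := by
  rw [bucketSum, Finset.sum_Ico_succ_top hsj, bucketSum]

theorem scanRound_inv (D : WindowData n m h i₀ p Q) (hε : 0 < ε) (I : ScanInv n m p ε h i₀ Q σ)
    (hj : σ.nat 4 + 1 < n) :
    ScanInv n m p ε h i₀ Q (scanRound.exec σ) ∧ (scanRound.exec σ).nat 4 = σ.nat 4 + 1 := by
  have hδ : 0 < ε / 64 := by positivity
  set τ : Memory := (Program.setNat 4 (.add (.var 4) (.const 1))).exec σ with hτ
  have F : Frame n m p ε h i₀ Q τ := by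
    have F := I.frame
    constructor <;> simp [hτ, Program.exec, NatExp.eval, F.nat_zero, F.nat_one, F.nat_two,
      F.nat_three, F.real_zero, F.real_one, F.arr_zero]
  have t4 : τ.nat 4 = σ.nat 4 + 1 := by simp [hτ, Program.exec, NatExp.eval]
  have t5 : τ.nat 5 = σ.nat 5 := by simp [hτ, Program.exec]
  have tr : τ.real = σ.real := rfl
  have ta : τ.arr = σ.arr := rfl
  have hb := breakTest_holds hε F
  rw [t4, t5] at hb
  have hsj := I.state.start_le
  have hexec : scanRound.exec σ = (Program.ite breakTest openBucket extendBucket).exec τ := rfl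
  by_cases hbr : breakTest.holds τ
  · have he : scanRound.exec σ = openBucket.exec τ := by rw [hexec, Program.exec, if_pos hbr]
    rw [he]
    have e4 : (openBucket.exec τ).nat 4 = σ.nat 4 + 1 := by
      simp [openBucket, Program.exec, NatExp.eval, t4]
    have e5 : (openBucket.exec τ).nat 5 = σ.nat 4 + 1 := by
      simp [openBucket, Program.exec, NatExp.eval, t4]
    have ea : (openBucket.exec τ).arr 2 = Function.update (σ.arr 2) (σ.nat 4 + 1) 1 := by
      simp [openBucket, Program.exec, NatExp.eval, RealExp.eval, t4, ta]
    refine ⟨⟨?_, ?_, ?_⟩, e4⟩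
    · constructor <;> simp [openBucket, Program.exec, NatExp.eval, F.nat_zero, F.nat_one,
        F.nat_two, F.nat_three, F.real_zero, F.real_one, F.arr_zero]
    · rw [e4, e5, ea]
      exact I.state.break D hδ hj (hb.1 hbr)
        (fun i hi => Function.update_of_ne (by omega) _ _) (Function.update_self _ _ _)
    · rw [e4, e5]
      simp [openBucket, Program.exec, RealExp.eval, bucketSum]
  · have he : scanRound.exec σ = extendBucket.exec τ := by rw [hexec, Program.exec, if_neg hbr]
    rw [he]
    rw [hb, not_or] at hbr
    have e4 : (extendBucket.exec τ).nat 4 = σ.nat 4 + 1 := by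
      simp [extendBucket, Program.exec, t4]
    have e5 : (extendBucket.exec τ).nat 5 = σ.nat 5 := by
      simp [extendBucket, Program.exec, t5]
    have er : (extendBucket.exec τ).real 2 = bucketSum p (σ.nat 5) (σ.nat 4 + 1) := by
      rw [bucketSum_succ (by omega), ← I.sum_eq]
      simp [extendBucket, Program.exec, RealExp.eval, NatExp.eval, length, t4, t5, tr, F.arr_zero]
    have hcast : ((σ.nat 4 + 1 - σ.nat 5 + 1 : ℕ) : ℝ) =
        ((σ.nat 4 + 1 : ℕ) : ℝ) - σ.nat 5 + 1 := by
      rw [Nat.cast_add_one, Nat.cast_sub (by omega)]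
    have ea : (extendBucket.exec τ).arr 2 =
        Function.update (Function.update (Function.update (σ.arr 2) (σ.nat 4) 0) (σ.nat 5)
          (((σ.nat 4 + 1 : ℕ) : ℝ) - σ.nat 5 + 1 - bucketSum p (σ.nat 5) (σ.nat 4 + 1) /
            (p (σ.nat 4 + 1) - p (σ.nat 5)))) (σ.nat 4 + 1)
          (bucketSum p (σ.nat 5) (σ.nat 4 + 1) / (p (σ.nat 4 + 1) - p (σ.nat 5))) := by
      rw [← hcast, bucketSum_succ (by omega), ← I.sum_eq]
      simp [extendBucket, Program.exec, RealExp.eval, NatExp.eval, length, t4, t5, tr, ta,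
        I.frame.arr_zero]
    refine ⟨⟨?_, ?_, ?_⟩, e4⟩
    · constructor <;> simp [extendBucket, Program.exec, F.nat_zero, F.nat_one,
        F.nat_two, F.nat_three, F.real_zero, F.real_one, F.arr_zero]
    · rw [e4, e5, ea]
      refine I.state.extend hj hbr.1 hbr.2 (fun i hi => ?_) (fun i h1 h2 => ?_)
      · rw [Function.update_of_ne (by omega), Function.update_of_ne (by omega),
          Function.update_of_ne (by omega)]
      · unfold bucketWeight
        by_cases hi : i = σ.nat 4 + 1
        · rw [if_neg (by omega), if_pos hi, hi, Function.update_self]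
        · rw [Function.update_of_ne hi]
          by_cases his : i = σ.nat 5
          · rw [if_pos his, his, Function.update_self]
          · rw [Function.update_of_ne his, if_neg his, if_neg hi]
            by_cases hij : i = σ.nat 4
            · rw [hij, Function.update_self]
            · rw [Function.update_of_ne hij, I.state.current i h1 (by omega), bucketWeight,
                if_neg his, if_neg hij]
    · rw [er, e4, e5]

theorem scan_computes (D : WindowData n m h i₀ p Q) (hε : 0 < ε) (F : Frame n m p ε h i₀ Q σ) :
    Computes scan σ n
      fun τ => ∃ s j, j + 1 = n ∧ Frame n m p ε h i₀ Q τ ∧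
        ScanState n m h i₀ p (ε / 64) Q s j (τ.arr 2) := by
  refine (Computes.of_straight (p := scanInit) (R := ScanInv n m p ε h i₀ Q)
    (by simp [scanInit, Program.Straight]) ⟨?_, ?_, ?_⟩).seq fun τ I => ?_
  · constructor <;> simp [scanInit, Program.exec, NatExp.eval, F.nat_zero, F.nat_one,
        F.nat_two, F.nat_three, F.real_zero, F.real_one, F.arr_zero]
  · have e4 : (scanInit.exec σ).nat 4 = 0 := by simp [scanInit, Program.exec, NatExp.eval]
    have e5 : (scanInit.exec σ).nat 5 = 0 := by simp [scanInit, Program.exec, NatExp.eval]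
    rw [e4, e5]
    exact ScanState.init D (by positivity) (by simp [scanInit, Program.exec, NatExp.eval,
      RealExp.eval])
  · simp [scanInit, Program.exec, NatExp.eval, RealExp.eval, bucketSum]
  · refine (Computes.loop (I := ScanInv n m p ε h i₀ Q) (v := fun τ => n - τ.nat 4)
      (by simp [scanRound, openBucket, extendBucket, Program.Straight]) ?_ I
      (Nat.sub_le _ _)).mono ?_
    · intro τ I hb
      simp only [Test.holds, NatExp.eval, I.frame.nat_zero] at hb
      obtain ⟨h1, h2⟩ := scanRound_inv D hε I hb
      refine ⟨h1, ?_⟩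
      rw [h2]
      omega
    · rintro τ ⟨I, hb⟩
      simp only [Test.holds, NatExp.eval, I.frame.nat_zero] at hb
      have := I.state.lt
      exact ⟨_, _, by omega, I.frame, I.state⟩

/-- The invariant of `compact`: integer registers `4` and `6` hold the numbers of points read and
written so far, and the entries written are those of positive weight among the points read, listed
by `g`. -/
def CompactInv (n : ℕ) (p W : ℕ → ℝ) (σ : Memory) : Prop :=
  σ.nat 0 = n ∧ σ.arr 2 = W ∧ σ.nat 4 ≤ n ∧ σ.nat 6 ≤ σ.nat 4 ∧
    (∀ i, σ.nat 4 ≤ i → σ.arr 0 i = p i) ∧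
    ∃ g : ℕ → ℕ, Set.BijOn g (Set.Iio (σ.nat 6)) {i | i < σ.nat 4 ∧ 0 < W i} ∧
      ∀ i < σ.nat 6, σ.arr 0 i = p (g i) ∧ σ.arr 1 i = W (g i)

theorem compactRound_inv {W : ℕ → ℝ} (I : CompactInv n p W σ) (hj : σ.nat 4 < n) :
    CompactInv n p W (compactRound.exec σ) ∧ (compactRound.exec σ).nat 4 = σ.nat 4 + 1 := by
  obtain ⟨h0, h2, h4, h6, hp, g, hg, hgv⟩ := I
  by_cases hW : 0 < W (σ.nat 4)
  · have hb : (Test.realLt (.const 0) (.get 2 (.var 4))).holds σ := by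
      simpa [Test.holds, RealExp.eval, NatExp.eval, h2] using hW
    have en : (compactRound.exec σ).nat =
        Function.update (Function.update σ.nat 6 (σ.nat 6 + 1)) 4 (σ.nat 4 + 1) := by
      simp [compactRound, Program.exec, if_pos hb, NatExp.eval]
    have e0 : (compactRound.exec σ).arr 0 =
        Function.update (σ.arr 0) (σ.nat 6) (p (σ.nat 4)) := by
      simp [compactRound, Program.exec, if_pos hb, NatExp.eval, RealExp.eval, hp]
    have e1 : (compactRound.exec σ).arr 1 =
        Function.update (σ.arr 1) (σ.nat 6) (W (σ.nat 4)) := by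
      simp [compactRound, Program.exec, if_pos hb, NatExp.eval, RealExp.eval, h2]
    have e2 : (compactRound.exec σ).arr 2 = W := by
      simp [compactRound, Program.exec, if_pos hb, h2]
    have n0 : (compactRound.exec σ).nat 0 = n := by rw [en]; simp [h0]
    have n4 : (compactRound.exec σ).nat 4 = σ.nat 4 + 1 := by rw [en]; simp
    have n6 : (compactRound.exec σ).nat 6 = σ.nat 6 + 1 := by rw [en]; simp
    refine ⟨⟨n0, e2, by omega, by omega, fun i hi => ?_,
      Function.update g (σ.nat 6) (σ.nat 4), ?_, fun i hi => ?_⟩, n4⟩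
    · rw [e0, Function.update_of_ne (by omega)]
      exact hp i (by omega)
    · rw [n4, n6]
      have hs : Set.Iio (σ.nat 6 + 1) = insert (σ.nat 6) (Set.Iio (σ.nat 6)) := by
        ext i; simp only [Set.mem_Iio, Set.mem_insert_iff]; omega
      have ht : {i | i < σ.nat 4 + 1 ∧ 0 < W i} =
          insert (Function.update g (σ.nat 6) (σ.nat 4) (σ.nat 6))
            {i | i < σ.nat 4 ∧ 0 < W i} := by
        ext i
        simp only [Function.update_self, Set.mem_insert_iff, Set.mem_ofPred_eq]
        constructor
        · rintro ⟨h1, h2⟩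
          rcases Nat.lt_succ_iff_lt_or_eq.1 h1 with h1 | h1
          · exact Or.inr ⟨h1, h2⟩
          · exact Or.inl h1
        · rintro (rfl | ⟨h1, h2⟩)
          · exact ⟨by omega, hW⟩
          · exact ⟨by omega, h2⟩
      rw [hs, ht]
      refine Set.BijOn.insert (hg.congr fun i hi => ?_) (by simp)
      rw [Function.update_of_ne (ne_of_lt hi)]
    · rw [n6] at hi
      rw [e0, e1]
      rcases Nat.lt_succ_iff_lt_or_eq.1 hi with hi | rfl
      · rw [Function.update_of_ne hi.ne, Function.update_of_ne hi.ne,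
          Function.update_of_ne hi.ne]
        exact hgv i hi
      · simp only [Function.update_self, and_self]
  · have hb : ¬ (Test.realLt (.const 0) (.get 2 (.var 4))).holds σ := by
      simpa [Test.holds, RealExp.eval, NatExp.eval, h2] using hW
    have he : compactRound.exec σ =
        { σ with nat := Function.update σ.nat 4 (σ.nat 4 + 1) } := by
      simp [compactRound, Program.exec, if_neg hb, NatExp.eval]
    rw [he]
    refine ⟨⟨by simp [h0], h2, by simp; omega, by simp; omega, fun i hi => ?_, g, ?_, ?_⟩, by simp⟩
    · simp only [Function.update_self] at hi
      exact hp i (by omega)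
    · have ht : {i | i < σ.nat 4 + 1 ∧ 0 < W i} = {i | i < σ.nat 4 ∧ 0 < W i} := by
        ext i
        simp only [Set.mem_ofPred_eq]
        refine ⟨fun ⟨h1, h2⟩ => ⟨?_, h2⟩, fun ⟨h1, h2⟩ => ⟨by omega, h2⟩⟩
        rcases Nat.lt_succ_iff_lt_or_eq.1 h1 with h1 | rfl
        · exact h1
        · exact absurd h2 hW
      simp only [Function.update_self]
      rw [ht]
      simpa using hg
    · simpa using hgv

theorem compact_computes (hp : StrictMonoOn p (Set.Iio n)) (h0 : σ.nat 0 = n) (ha : σ.arr 0 = p)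
    (hW : ∀ i < n, 0 ≤ σ.arr 2 i) :
    Computes compact σ n
      fun τ => ∀ w : ℝ → ℝ, (∀ i < n, w (p i) = σ.arr 2 i) →
        Presents τ (((Finset.range n).filter fun i => σ.arr 2 i ≠ 0).image p) w := by
  refine (Computes.of_straight (R := CompactInv n p (σ.arr 2)) (by simp [Program.Straight])
    ?_).seq fun τ I => ?_
  · refine ⟨?_, ?_, ?_, ?_, ?_, id, ?_, ?_⟩ <;> simp [Program.exec, NatExp.eval, h0, ha]
  refine (Computes.loop (I := CompactInv n p (σ.arr 2)) (v := fun τ => n - τ.nat 4)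
      (by simp [compactRound, Program.Straight]) ?_ I (Nat.sub_le _ _)).seq ?_
  · intro τ I hb
    simp only [Test.holds, NatExp.eval, I.1] at hb
    obtain ⟨h1, h2⟩ := compactRound_inv I hb
    refine ⟨h1, ?_⟩
    rw [h2]
    omega
  · rintro τ ⟨⟨h0, -, h4, h6, -, g, hg, hgv⟩, hb⟩
    simp only [Test.holds, NatExp.eval, h0] at hb
    have h4 : τ.nat 4 = n := by omega
    rw [h4] at hg
    refine Computes.of_straight (by trivial) fun w hw => ?_
    simp only [Program.exec, NatExp.eval, Presents, Function.update_self]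
    have hset : {i | i < n ∧ 0 < σ.arr 2 i} =
        (((Finset.range n).filter fun i => σ.arr 2 i ≠ 0 : Finset ℕ) : Set ℕ) := by
      ext i
      simp only [Set.mem_ofPred_eq, Finset.coe_filter, Finset.mem_range]
      exact and_congr_right fun hi => ⟨fun h => h.ne', fun h => lt_of_le_of_ne (hW i hi) h.symm⟩
    refine ⟨?_, fun i hi => ?_⟩
    · have hb : Set.BijOn (p ∘ g) (Set.Iio (τ.nat 6))
          (p '' {i | i < n ∧ 0 < σ.arr 2 i}) :=
        Set.BijOn.comp (Set.InjOn.bijOn_image (hp.injOn.mono fun i hi => hi.1)) hg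
      rw [Finset.coe_image, ← hset]
      exact hb.congr fun i hi => ((hgv i hi).1).symm
    · rw [(hgv i hi).1, (hgv i hi).2]
      exact hw _ (hg.mapsTo hi).1

theorem coreset_computes (hp : StrictMonoOn p (Set.Iio n)) (hm : 1 ≤ m) (hmn : 4 * m ≤ n)
    (hε : 0 < ε) (F : Frame n m p ε 0 0 0 σ) :
    Computes coreset σ n fun τ =>
      ∃ h i₀ Q s j W, j + 1 = n ∧ WindowData n m h i₀ p Q ∧
        ScanState n m h i₀ p (ε / 64) Q s j W ∧ ∀ w : ℝ → ℝ, (∀ i < n, w (p i) = W i) →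
          Presents τ (((Finset.range n).filter fun i => W i ≠ 0).image p) w := by
  refine (findMedian_computes F).seq ?_
  rintro σ₁ ⟨h, hh1, hh2, F₁⟩
  refine (findWindow_computes (by omega) F₁).seq ?_
  rintro σ₂ ⟨i₀, hi₀, hl, hr, F₂⟩
  refine (sumWindow_computes hp (by omega) hi₀ (by omega) F₂).seq fun σ₃ F₃ => ?_
  have D : WindowData n m h i₀ p (∑ i ∈ Finset.Ico i₀ (i₀ + (n - m)), |p i - p h|) :=
    ⟨hm, hmn, hp, hh1, hh2, hi₀, hl, hr, rfl⟩
  refine (scan_computes D hε F₃).seq ?_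
  rintro σ₄ ⟨s, j, hj, F₄, S⟩
  have hB := S.closed_succ D
  rw [hj] at hB
  exact (compact_computes hp F₄.nat_zero F₄.arr_zero hB.nonneg).mono fun τ hτ =>
    ⟨h, i₀, _, s, j, σ₄.arr 2, hj, D, S, hτ⟩

theorem input_arr_of_lt {P : Finset ℝ} {m i : ℕ} {ε : ℝ} (hi : i < P.card) :
    (input P m ε).arr 0 i = P.orderEmbOfFin rfl ⟨i, hi⟩ := by
  simp [input, hi]

theorem input_strictMonoOn (P : Finset ℝ) (m : ℕ) (ε : ℝ) :
    StrictMonoOn ((input P m ε).arr 0) (Set.Iio P.card) := by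
  intro i hi j hj hij
  rw [input_arr_of_lt hi, input_arr_of_lt hj]
  exact (P.orderEmbOfFin rfl).strictMono hij

theorem points_input (P : Finset ℝ) (m : ℕ) (ε : ℝ) :
    points P.card ((input P m ε).arr 0) = P := by
  refine Finset.eq_of_subset_of_card_le (fun q hq => ?_) ?_
  · obtain ⟨i, hi, rfl⟩ := Finset.mem_image.1 hq
    rw [input_arr_of_lt (Finset.mem_range.1 hi)]
    exact Finset.orderEmbOfFin_mem _ _ _
  · rw [points, Finset.card_image_of_injOn, Finset.card_range]
    exact (input_strictMonoOn P m ε).injOn.mono fun _ hi => by simpa using hi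

theorem exists_weight {W : ℕ → ℝ} (hp : StrictMonoOn p (Set.Iio n)) :
    ∃ w : ℝ → ℝ, ∀ i < n, w (p i) = W i :=
  ⟨fun x => W (Function.invFunOn p (Set.Iio n) x), fun _ hi =>
    congrArg W (hp.injOn.leftInvOn_invFunOn (Set.mem_Iio.2 hi))⟩

/-- The number of nonzero weights in terms of the coreset rate. -/
theorem count_bound_le {n m : ℕ} {ε : ℝ} (hε : 0 < ε) (hε1 : ε < 1) :
    2 * (2 * m / (ε / 64 * n) + 2 / √(ε / 64) + 6) ≤ 300 * coresetRate n m ε := by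
  have h64 : √(64 : ℝ) = 8 := by
    rw [show (64 : ℝ) = 8 ^ 2 by norm_num, Real.sqrt_sq (by norm_num)]
  have hs0 : 0 < √ε := Real.sqrt_pos.2 hε
  have hs1 : √ε ≤ 1 := Real.sqrt_le_one.2 hε1.le
  have h1 : 1 ≤ (√ε)⁻¹ := (one_le_inv₀ hs0).2 hs1
  have h2 : 2 / √(ε / 64) = 16 * (√ε)⁻¹ := by
    rw [Real.sqrt_div hε.le, h64]
    field_simp
    norm_num
  have h3 : 2 * (m : ℝ) / (ε / 64 * n) = 128 * ((m : ℝ) / n * ε⁻¹) := by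
    rw [div_eq_mul_inv, div_eq_mul_inv, mul_inv, div_eq_mul_inv, mul_inv, inv_inv]
    ring
  have h4 : 0 ≤ (m : ℝ) / n * ε⁻¹ := by positivity
  rw [coresetRate, rpow_neg_half_eq hε, h2, h3]
  linarith

theorem exists_coreset (n m : ℕ) (ε : ℝ) (P : Finset ℝ) (hm : 1 ≤ m) (hmn : 4 * m ≤ n)
    (hε : 0 < ε) (hε1 : ε < 1) (hP : P.card = n) :
    ∃ (σ : Memory) (t : ℕ) (S : Finset ℝ) (w : ℝ → ℝ),
      Run coreset (input P m ε) σ t ∧ t ≤ 2 * coreset.maxSteps * n ∧ Presents σ S w ∧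
        IsRobustCoreset m ε P S w ∧ (S.card : ℝ) ≤ 300 * coresetRate n m ε := by
  subst hP
  have hp := input_strictMonoOn P m ε
  have F : Frame P.card m ((input P m ε).arr 0) ε 0 0 0 (input P m ε) := by
    constructor <;> simp [input]
  obtain ⟨σ, t, hrun, ht, h, i₀, Q, s, j, W, hj, D, S, hpres⟩ :=
    coreset_computes hp hm hmn hε F
  obtain ⟨w, hw⟩ := exists_weight (W := W) hp
  have hB := S.closed_succ D
  have hc := S.count_le D (by positivity)
  rw [hj] at hB hc
  have hcore := D.isRobustCoreset hε hB hw
  rw [points_input] at hcore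
  refine ⟨σ, t, _, w, hrun, ht.trans ?_, hpres w hw, hcore, ?_⟩
  · rw [mul_assoc, mul_left_comm]
    exact Nat.mul_le_mul_left _ (by omega)
  · rw [D.card_image fun i hi => Finset.mem_range.1 (Finset.mem_filter.1 hi).1]
    exact hc.trans (count_bound_le hε hε1)

end CoresetProgram

end RealRAM

theorem theorem2 :
    -- a linear-time algorithm whose output is a coreset of nearly optimal size
    (∃ (A : RealRAM.Program) (T K k : ℕ),
      ∀ (n m : ℕ) (ε : ℝ) (P : Finset ℝ), 1 ≤ m → 4 * m ≤ n → 0 < ε → ε < 1 → P.card = n →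
        ∃ (σ : RealRAM.Memory) (t : ℕ) (S : Finset ℝ) (w : ℝ → ℝ),
          RealRAM.Run A (RealRAM.input P m ε) σ t ∧ t ≤ T * n ∧
          RealRAM.Presents σ S w ∧ IsRobustCoreset m ε P S w ∧
          (S.card : ℝ) ≤ K * coresetRate n m ε * (1 + Real.log (coresetRate n m ε)) ^ k) ∧
    -- the matching lower bound, valid even for weighted sets that are not contained in the dataset
    (∃ κ : ℝ, 0 < κ ∧
      ∀ (n m : ℕ) (ε : ℝ), 1 ≤ m → 4 * m ≤ n → 0 < ε → ε < 1 → 1 < ε * n →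
        ∃ X : Finset ℝ, X.card = n ∧
          ∀ (S : Finset ℝ) (w : ℝ → ℝ), PreservesRobustCost m ε X S w →
            κ * coresetRate n m ε ≤ S.card) := by
  refine ⟨⟨RealRAM.CoresetProgram.coreset, 2 * RealRAM.CoresetProgram.coreset.maxSteps, 300, 0,
    fun n m ε P hm hmn hε hε1 hP => ?_⟩, 1 / 100, by norm_num,
    fun n m ε _ hmn hε hε1 hn => exists_forall_coresetRate_le_card hmn hε hε1 hn⟩
  obtain ⟨σ, t, S, w, h1, h2, h3, h4, h5⟩ :=
    RealRAM.CoresetProgram.exists_coreset n m ε P hm hmn hε hε1 hP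
  refine ⟨σ, t, S, w, h1, h2, h3, h4, ?_⟩
  rw [pow_zero, mul_one]
  exact_mod_cast h5
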